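/- Let $d\ge 1$ and $n,k\ge 0$ be integers with $n+k=3d-1$. We consider parametrized rational tropical curves $h:\Gamma\to\mathbb{R}^2$ of degree $d$, that is, with $d$ labelled ends of each of the slopes $(0,-1)$, $(-1,0)$, $(1,1)$, and with $n+1$ marked points (labelled contracted ends). Marked ends count towards valencies. Let $M$ be the subfan $\mathcal{M}_{0,n+1}(\mathbb{R}^2,d)\cap\psi_{n+1}^k$ of the moduli space of these curves. The maximal cones of $M$ are the combinatorial types whose vertex $V_0$ adjacent to the last marked point has valency $k+3$ and all of whose other vertices are trivalent; they have weight $1$. On a cone, the integral structure is given by the image of a base vertex and the lengths of the bounded edges. Let $\mathrm{ev}:M\to(\mathbb{R}^2)^{n}\times\mathbb{R}^2$ be the evaluation at the marked points, let $P_1,\dots,P_n\in\mathbb{R}^2$, and let $L=\bigcup_{r}(Q+\mathbb{R}_{\ge 0}\,r)$, $r\in\{(0,-1),(-1,0),(1,1)\}$, be the standard tropical line with vertex $Q\in\mathbb{R}^2$. A solution is a curve of $M$ that $\mathrm{ev}$ maps to $\Xi=\{P_1\}\times\cdots\times\{P_n\}\times L$. For generic $(P_1,\dots,P_n,Q)$,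 namely outside a finite union (depending only on $d,k,n$) of proper linear subspaces of $(\mathbb{R}^2)^{n+1}$, every solution $(\Gamma,h)$ has the following properties. It lies in the interior of a maximal cone of $M$, and $h(V_0)$ lies in the interior of exactly one ray of $L$; let $u$ be the primitive direction of this ray. The complement of the marked points in $\Gamma$ (marked points being regarded as the points where their contracted ends are attached) has a unique bounded component, and exactly one edge adjacent to $V_0$ lies in it; let $v$ be the outgoing slope of $h$ at $V_0$ on this edge. Let $m_\Gamma$ be the intersection multiplicity of $\mathrm{ev}$ and $\Xi$ at $(\Gamma,h)$, that is, the index in $(\mathbb{Z}^2)^{n+1}$ of the sum of the image under $\mathrm{ev}$ of the lattice of integral tangent vectors of the cone and of the lattice $\mathbb{Z}\,(0,\dots,0,u)$ (equivalently, the absolute value of the determinant of $\mathrm{ev}$ followed by the projection along $(0,\dots,0,u)$). Then $$m_\Gamma=|\det(u,v)|\prod_V m_V,$$ where $V$ runs over the trivalent vertices of $\Gamma$ that are not adjacent to a marked point, and $m_V=|\det(a_V,b_V)|$ for the outgoing slopes $a_V,b_V$ of any two of the edges or ends adjacent to $V$. -/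

import Mathlib

namespace TropDesc

/-- The determinant of two integer vectors of the plane. -/
def det (a b : ℤ × ℤ) : ℤ := a.1 * b.2 - a.2 * b.1

/-- An integer vector seen as a real vector. -/
def toReal (a : ℤ × ℤ) : ℝ × ℝ := ((a.1 : ℝ), (a.2 : ℝ))

/-- The three primitive directions `(0,-1)`, `(-1,0)`, `(1,1)` of the ends of tropical curves of
degree `d`, and of the rays of the standard tropical line. -/
def dir : Fin 3 → ℤ × ℤ := ![(0, -1), (-1, 0), (1, 1)]

/-- The combinatorial type of a parametrized rational tropical curve in the plane, of degree `d`
(there are `d` ends of each of the slopes `dir 0`, `dir 1`, `dir 2`, labelled by `Fin 3 × Fin d`),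
with `n + 1` marked points (contracted ends, labelled by `Fin (n + 1)`). `graph` consists of the
bounded edges. An end is recorded by the vertex it is adjacent to. `slope v w` is the slope of the
bounded edge `vw`, oriented from `v` to `w`. -/
structure CombType (d n : ℕ) where
  V : Type
  [fintypeV : Fintype V]
  [decEqV : DecidableEq V]
  graph : SimpleGraph V
  [decAdj : DecidableRel graph.Adj]
  isTree : graph.IsTree
  endFoot : Fin 3 × Fin d → V
  markFoot : Fin (n + 1) → V
  slope : V → V → ℤ × ℤ
  slope_symm : ∀ v w, graph.Adj v w → slope w v = -slope v w
  balanced : ∀ v, ∑ w ∈ graph.neighborFinset v, slope v w +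
    ∑ e with endFoot e = v, dir e.1 = 0

attribute [instance] CombType.fintypeV CombType.decEqV CombType.decAdj

namespace CombType

variable {d n : ℕ} (Γ : CombType d n)

/-- The valency of a vertex: bounded edges, ends and marked points are counted. -/
def valency (v : Γ.V) : ℕ :=
  Γ.graph.degree v + (Finset.univ.filter fun e => Γ.endFoot e = v).card +
    (Finset.univ.filter fun i => Γ.markFoot i = v).card

/-- The vertex is adjacent to no marked point. -/
abbrev IsUnmarked (v : Γ.V) : Prop := ∀ i, Γ.markFoot i ≠ v

/-- `Γ` is the type of a top-dimensional cone of the subfan cut out by the monomial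
`∏ ψ_i ^ (κ i)` in the moduli space of degree `d` tropical curves with `n + 1` marked points. -/
def IsPsiType (κ : Fin (n + 1) → ℕ) : Prop :=
  ∀ v, Γ.valency v = 3 + ∑ i with Γ.markFoot i = v, κ i

/-- The weight of the cone of `Γ` in the subfan cut out by `∏ ψ_i ^ (κ i)`: the product over the
vertices of the multinomial coefficients of the powers carried by their marked points. -/
def psiWeight (κ : Fin (n + 1) → ℕ) : ℕ :=
  ∏ v, Nat.multinomial (Finset.univ.filter fun i => Γ.markFoot i = v) κ

/-- A point of the closed cone of `Γ`: a map `h` with the given slopes, recorded by the images of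
the vertices and the lengths of the bounded edges. If some lengths vanish, it represents the curve
in which these edges are contracted (a point on the boundary of the cone). -/
structure Curve where
  pos : Γ.V → ℝ × ℝ
  len : Γ.graph.edgeSet → ℝ
  len_nonneg : ∀ e, 0 ≤ len e
  affine : ∀ v w (hvw : Γ.graph.Adj v w),
    pos w - pos v = len ⟨s(v, w), hvw⟩ • toReal (Γ.slope v w)

/-- The lattice of integral tangent vectors of the cone of `Γ`: integral variations of the images
of the vertices and of the lengths. (A base vertex identifies it with `ℤ² × ℤ^E`, with `E` the set
of bounded edges.) -/
def tangentLattice : AddSubgroup ((Γ.V → ℤ × ℤ) × (Γ.graph.edgeSet → ℤ)) where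
  carrier := {x | ∀ v w (hvw : Γ.graph.Adj v w),
    x.1 w - x.1 v = x.2 ⟨s(v, w), hvw⟩ • Γ.slope v w}
  zero_mem' := by intro v w hvw; simp
  add_mem' := by
    intro a b ha hb v w hvw
    have h1 := ha v w hvw
    have h2 := hb v w hvw
    simp only [Prod.fst_add, Prod.snd_add, Pi.add_apply, add_smul, ← h1, ← h2]
    abel
  neg_mem' := by
    intro a ha v w hvw
    have h1 := ha v w hvw
    simp only [Prod.fst_neg, Prod.snd_neg, Pi.neg_apply, neg_smul, ← h1]
    abel

/-- The (linear part of the) evaluation map at the marked points. -/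
def evaluation : (Γ.V → ℤ × ℤ) × (Γ.graph.edgeSet → ℤ) →+ (Fin (n + 1) → ℤ × ℤ) where
  toFun x i := x.1 (Γ.markFoot i)
  map_zero' := rfl
  map_add' _ _ := rfl

/-- The intersection multiplicity, on the cone of `Γ` in the subfan of `∏ ψ_i ^ (κ i)`, of the
evaluation map with a cycle `{P_1} × ⋯ × {P_n} × L` at a point where `L` has primitive direction
`u`: the weight of the cone times the index in `(ℤ²)^(n+1)` of the sum of the image of the
tangent lattice of the cone and of the lattice `ℤ (0, …, 0, u)` of the cycle. It is the absolute
value of the determinant, in integral coordinates, of the evaluation map followed by the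
projection along `(0, …, 0, u)`; an infinite index counts as `0`. -/
noncomputable def multiplicity (κ : Fin (n + 1) → ℕ) (u : ℤ × ℤ) : ℕ :=
  Γ.psiWeight κ * (Γ.tangentLattice.map Γ.evaluation ⊔
    AddSubgroup.zmultiples (Pi.single (Fin.last n) u : Fin (n + 1) → ℤ × ℤ)).index

/-- The bounded edges and the ends of non-zero slope. -/
abbrev Cell : Type := Γ.graph.edgeSet ⊕ (Fin 3 × Fin d)

/-- The vertex `v` is an extremity of the edge or end. -/
def Touches (v : Γ.V) : Γ.Cell → Prop
  | Sum.inl e => v ∈ e.1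
  | Sum.inr e => Γ.endFoot e = v

/-- Two edges or ends share an unmarked vertex. -/
def Joined (x y : Γ.Cell) : Prop := ∃ v, Γ.IsUnmarked v ∧ Γ.Touches v x ∧ Γ.Touches v y

/-- The connected components of the complement of the marked points (as every component contains
an edge or an end, it is given by the set of its edges and ends). -/
def Component : Type := Quot Γ.Joined

/-- A component is bounded if it contains no end. -/
def Component.IsBounded {Γ : CombType d n} (c : Γ.Component) : Prop :=
  ∀ e : Fin 3 × Fin d, Quot.mk Γ.Joined (Sum.inr e) ≠ c

/-- There is a bounded edge `vw`, and it lies in a bounded component of the complement of the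
marked points. -/
def IsBoundedDirection (v w : Γ.V) : Prop :=
  ∃ hvw : Γ.graph.Adj v w,
    Component.IsBounded (Γ := Γ) (Quot.mk Γ.Joined (Sum.inl ⟨s(v, w), hvw⟩))

/-- `a` is a bounded edge (given by its other extremity) or an end adjacent to `v`. -/
def IsFlag (v : Γ.V) : Γ.V ⊕ (Fin 3 × Fin d) → Prop
  | Sum.inl w => Γ.graph.Adj v w
  | Sum.inr e => Γ.endFoot e = v

/-- The outgoing slope at `v` of an adjacent edge or end. -/
def flagSlope (v : Γ.V) : Γ.V ⊕ (Fin 3 × Fin d) → ℤ × ℤ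
  | Sum.inl w => Γ.slope v w
  | Sum.inr e => dir e.1

/-- `m` is the absolute value of the determinant of the outgoing slopes of two distinct edges or
ends adjacent to `v`. (At an unmarked trivalent vertex it does not depend on the choice of the
two, by balancing.) -/
def IsVertexMultiplicity (v : Γ.V) (m : ℕ) : Prop :=
  ∃ a b, a ≠ b ∧ Γ.IsFlag v a ∧ Γ.IsFlag v b ∧
    m = (det (Γ.flagSlope v a) (Γ.flagSlope v b)).natAbs

/-- The vertex adjacent to the last marked point, the one with the line constraint. -/
def lineVertex : Γ.V := Γ.markFoot (Fin.last n)

end CombType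

/-- The closed ray number `j` of the standard tropical line with vertex `Q`. -/
def closedRay (Q : ℝ × ℝ) (j : Fin 3) : Set (ℝ × ℝ) := {x | ∃ t : ℝ, 0 ≤ t ∧ x = Q + t • toReal (dir j)}

/-- The open ray number `j` of the standard tropical line with vertex `Q`. -/
def openRay (Q : ℝ × ℝ) (j : Fin 3) : Set (ℝ × ℝ) := {x | ∃ t : ℝ, 0 < t ∧ x = Q + t • toReal (dir j)}

/-- The standard tropical line with vertex `Q`. -/
def tropicalLine (Q : ℝ × ℝ) : Set (ℝ × ℝ) := ⋃ j, closedRay Q j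

/-- The exponents of the monomial `ψ^k` at the last marked point. -/
def lastPsi (n k : ℕ) : Fin (n + 1) → ℕ := Pi.single (Fin.last n) k

/-- The curve maps the first `n` marked points to the points `P i`, and the last one to the
tropical line with vertex `Q`. -/
def CombType.Curve.Satisfies {d n : ℕ} {Γ : CombType d n} (h : Γ.Curve)
    (P : Fin n → ℝ × ℝ) (Q : ℝ × ℝ) : Prop :=
  (∀ i : Fin n, h.pos (Γ.markFoot i.castSucc) = P i) ∧ h.pos Γ.lineVertex ∈ tropicalLine Q

end TropDesc

/-!
The curves of a fixed combinatorial type `Γ` that satisfy the conditions are the solutions of a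
linear system: the unknowns are the images of the vertices, the lengths of the bounded edges and the
position of the last marked point on the line; the equations say that the difference of the
extremities of an edge is the length times the slope, and that the marked points are mapped to the
given points and to the line (`constraintMap`). The valencies force this system to be square.

*Genericity.* Up to names of vertices and edges there are finitely many such systems, because
balancing makes every slope a sum of directions of ends (`CombType.exists_slope_eq_sum`). If the
system of `Γ` is singular, the conditions that it can meet form a proper subspace. If it is regular,
the conditions met with a vanishing length, or with the last marked point at the vertex of the line,
form a proper subspace. All proper subspaces of these kinds, for any incidences of the same size and
any sums of directions as slopes, are exceptional (`exceptionalSubspaces`), so that the system of a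
solution for generic conditions is regular (`CombType.regular_of_satisfies`).

*Reduction to moments.* The multiplicity is the index of the image of the integral system
(`CombType.multiplicity_eq_index`), since differences along the edges of a tree can be prescribed.
Eliminating the lengths replaces the planar equation of an edge by its determinant with the slope of
the edge, without changing the absolute value of the determinant of the system
(`natAbs_det_constraintMatrix`). In the resulting matrix every vertex has two columns, and the row
of an edge only involves the extremities of this edge.

*The flow.* As the determinant does not vanish, one of the terms of its Leibniz expansion does not
vanish (`exists_assignment`). This term assigns every equation to a column it involves, so it
orients every edge towards one of its extremities. A vertex receives exactly two equations: the two
coordinates of the point condition at one of the first `n` marked points, the line and one edge at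
the last marked point, and two edges at an unmarked vertex (`CombType.IsAssignment.isFlow`). An
orientation of a tree has no directed cycles (`CombType.IsFlow.irrefl`), so the matrix is block
triangular and its determinant is the product of the `2 × 2` determinants at the vertices
(`CombType.IsAssignment.natAbs_det`), which are the factors of the formula.

*Components.* An unmarked vertex has valency three and two incoming edges, hence a unique outgoing
edge or end. Following the flow, every component of the complement of the marked points leads either
to an end or to the unique edge that points to the last marked point. The component of this edge is
therefore the only bounded one (`CombType.IsFlow.isBounded_iff`), and no other edge at the last
marked point lies in it, as its flow would close up to a directed cycle
(`CombType.IsFlow.isBoundedDirection_iff`).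
-/

namespace TropDesc

open Matrix

/-! ### Linear systems with planar unknowns -/

/-- The two coordinates of a planar vector. -/
def coord {R : Type*} (a : R × R) : Fin 2 → R := ![a.1, a.2]

/-- An integer vector of the plane, read in a commutative ring. -/
def castPair (R : Type*) [CommRing R] (a : ℤ × ℤ) : R × R := ((a.1 : R), (a.2 : R))

section LinearSystem

variable {V K N : Type*}

/-- The splitting of the coordinates of the planar equations used for eliminating the scalar
unknowns: for `k : K`, the first one is turned into the moment, the second one is solved for
`l k`. -/
def splitRows (K N : Type*) : (K ⊕ N × Fin 2) ⊕ K ≃ Fin 2 × (K ⊕ N) where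
  toFun := Sum.elim (Sum.elim (fun k => (0, Sum.inl k)) fun i => (i.2, Sum.inr i.1))
    fun k => (1, Sum.inl k)
  invFun r := Sum.elim (fun k => if r.1 = 0 then Sum.inl (Sum.inl k) else Sum.inr k)
    (fun i => Sum.inl (Sum.inr (i, r.1))) r.2
  left_inv := by rintro ((k | i) | k) <;> simp
  right_inv := by
    rintro ⟨b, k | i⟩
    · fin_cases b <;> simp
    · simp

/-- For a nonzero vector `(a, b)`, the row operation `(det ((a, b), ·), ⟨(a, b), ·⟩ / |(a, b)|²)`
of determinant `-1`. -/
noncomputable def eliminationBlock (s : K → ℤ × ℤ) : K ⊕ N → Matrix (Fin 2) (Fin 2) ℝ :=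
  Sum.elim (fun k => !![-((s k).2 : ℝ), ((s k).1 : ℝ);
    ((s k).1 : ℝ) / ((s k).1 ^ 2 + (s k).2 ^ 2), ((s k).2 : ℝ) / ((s k).1 ^ 2 + (s k).2 ^ 2)])
    fun _ => 1

theorem normSq_ne_zero {a : ℤ × ℤ} (ha : a ≠ 0) : ((a.1 : ℝ) ^ 2 + (a.2 : ℝ) ^ 2) ≠ 0 := by
  intro h
  apply ha
  have h1 : (a.1 : ℝ) = 0 := by nlinarith [sq_nonneg (a.1 : ℝ), sq_nonneg (a.2 : ℝ)]
  have h2 : (a.2 : ℝ) = 0 := by nlinarith [sq_nonneg (a.1 : ℝ), sq_nonneg (a.2 : ℝ)]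
  exact Prod.ext (by exact_mod_cast h1) (by exact_mod_cast h2)

theorem abs_det_eliminationBlock {s : K → ℤ × ℤ} (hs : ∀ k, s k ≠ 0) (o : K ⊕ N) :
    |(eliminationBlock s o).det| = 1 := by
  rcases o with k | i
  · have h := normSq_ne_zero (hs k)
    have : (eliminationBlock (N := N) s (Sum.inl k)).det = -1 := by
      simp only [eliminationBlock, Sum.elim_inl, det_fin_two_of]
      field_simp
      ring
    simp [this]
  · simp [eliminationBlock]

/-- A linear system whose unknowns are a planar vector `x v` for every `v : V` and a scalar `l k`
for every `k : K`. Every `o : K ⊕ N` contributes the planar form `∑ v, c o v • x v`, from which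
`l k • s k` is subtracted if `o` comes from `k : K`. -/
def constraintMap [Fintype V] (R : Type*) [CommRing R] (c : K ⊕ N → V → ℤ)
    (s : K → ℤ × ℤ) :
    ((V → R × R) × (K → R)) →+ (K ⊕ N → R × R) where
  toFun y o := ∑ v, (c o v : R) • y.1 v - Sum.elim (fun k => y.2 k • castPair R (s k)) 0 o
  map_zero' := by
    funext o
    rcases o with k | i <;> simp
  map_add' := by
    intro y z
    funext o
    rcases o with k | i
    · simp only [Prod.fst_add, Prod.snd_add, Pi.add_apply, smul_add, Finset.sum_add_distrib,
        Sum.elim_inl, add_smul]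
      abel
    · simp [Finset.sum_add_distrib]

/-- If `s k` vanishes, then the unknown `l k` does not occur in the system. -/
theorem slope_ne_zero_of_injective [Fintype V] [DecidableEq K] {c : K ⊕ N → V → ℤ}
    {s : K → ℤ × ℤ} (hinj : Function.Injective (constraintMap ℝ c s)) (k : K) : s k ≠ 0 := by
  intro hk
  have h : constraintMap ℝ c s (0, Pi.single k 1) = 0 := by
    funext o
    rcases o with k' | i
    · by_cases hkk : k' = k
      · subst hkk
        simp [constraintMap, hk, castPair]
      · simp [constraintMap, hkk]
    · simp [constraintMap]
  have := (injective_iff_map_eq_zero _).1 hinj _ h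
  have := congrFun (congrArg Prod.snd this) k
  simp at this

variable [DecidableEq K] [DecidableEq N]

/-- The matrix of `constraintMap` in coordinates. -/
def constraintMatrix (R : Type*) [CommRing R] (c : K ⊕ N → V → ℤ) (s : K → ℤ × ℤ) :
    Matrix (Fin 2 × (K ⊕ N)) ((V × Fin 2) ⊕ K) R :=
  Matrix.of fun r q => Sum.elim
    (fun p => if r.1 = p.2 then (c r.2 p.1 : R) else 0)
    (fun k => if r.2 = Sum.inl k then -coord (castPair R (s k)) r.1 else 0) q

/-- The system obtained from `constraintMap` by eliminating the scalar unknowns: the planar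
equation of `k : K` is replaced by its determinant with `s k`. -/
def momentMatrix (R : Type*) [CommRing R] (c : K ⊕ N → V → ℤ) (s : K → ℤ × ℤ) :
    Matrix (K ⊕ N × Fin 2) (V × Fin 2) R :=
  Matrix.of fun r p => Sum.elim
    (fun k => (c (Sum.inl k) p.1 : R) * ![-((s k).2 : R), ((s k).1 : R)] p.2)
    (fun i => if i.2 = p.2 then (c (Sum.inr i.1) p.1 : R) else 0) r

/-- The coordinates of the target of `constraintMap`. -/
def rowCoord (R : Type*) [CommRing R] (O : Type*) : (O → R × R) ≃+ (Fin 2 × O → R) where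
  toFun y r := coord (y r.2) r.1
  invFun z o := (z (0, o), z (1, o))
  left_inv y := by funext o; simp [coord]
  right_inv z := by funext ⟨b, o⟩; fin_cases b <;> simp [coord]
  map_add' y z := by funext ⟨b, o⟩; fin_cases b <;> simp [coord]

/-- The coordinates of the source of `constraintMap`. -/
def colCoord (R : Type*) [CommRing R] (V K : Type*) :
    ((V → R × R) × (K → R)) ≃+ ((V × Fin 2) ⊕ K → R) where
  toFun y := Sum.elim (fun p => coord (y.1 p.1) p.2) y.2
  invFun z := (fun v => (z (Sum.inl (v, 0)), z (Sum.inl (v, 1))), fun k => z (Sum.inr k))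
  left_inv y := by ext <;> simp [coord]
  right_inv z := by
    funext q
    rcases q with ⟨v, b⟩ | k
    · fin_cases b <;> simp [coord]
    · rfl
  map_add' y z := by
    funext q
    rcases q with ⟨v, b⟩ | k
    · fin_cases b <;> simp [coord]
    · rfl

theorem constraintMatrix_eq_map (c : K ⊕ N → V → ℤ) (s : K → ℤ × ℤ) :
    constraintMatrix ℝ c s = (constraintMatrix ℤ c s).map (Int.castRingHom ℝ) := by
  ext q q'
  rcases q' with p | k
  · simp [constraintMatrix, apply_ite (Int.cast : ℤ → ℝ)]
  · have h : ∀ b, coord (castPair ℝ (s k)) b = ((coord (castPair ℤ (s k)) b : ℤ) : ℝ) := by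
      intro b
      fin_cases b <;> simp [coord, castPair]
    simp [constraintMatrix, apply_ite (Int.cast : ℤ → ℝ), h]

theorem constraintMatrix_mulVec [Fintype V] [Fintype K] (R : Type*) [CommRing R]
    (c : K ⊕ N → V → ℤ) (s : K → ℤ × ℤ)
    (y : (V → R × R) × (K → R)) :
    constraintMatrix R c s *ᵥ colCoord R V K y = rowCoord R _ (constraintMap R c s y) := by
  funext ⟨b, o⟩
  rcases o with k | i <;> fin_cases b <;>
    simp [Matrix.mulVec, dotProduct, constraintMatrix, colCoord, rowCoord, constraintMap, coord,
      castPair, Fintype.sum_sum_type, Fintype.sum_prod_type, Prod.fst_sum, Prod.snd_sum,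
      ite_mul] <;> ring

/-- The row operations `eliminationBlock` make the system block triangular, with the moments as
equations for the planar unknowns. -/
theorem eliminationBlock_mul [Fintype K] [Fintype N] {c : K ⊕ N → V → ℤ} {s : K → ℤ × ℤ}
    (hs : ∀ k, s k ≠ 0) :
    ∃ X, (blockDiagonal (eliminationBlock s) * constraintMatrix ℝ c s).submatrix
      (splitRows K N) id = fromBlocks (momentMatrix ℝ c s) 0 X (-1) := by
  have hmul : ∀ b o q, (blockDiagonal (eliminationBlock s) * constraintMatrix ℝ c s :
      Matrix (Fin 2 × (K ⊕ N)) ((V × Fin 2) ⊕ K) ℝ) (b, o) q =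
      eliminationBlock s o b 0 * constraintMatrix ℝ c s (0, o) q +
        eliminationBlock s o b 1 * constraintMatrix ℝ c s (1, o) q := by
    intro b o q
    refine (Matrix.mul_apply (M := blockDiagonal (eliminationBlock s))).trans ?_
    simp [blockDiagonal_apply, Fintype.sum_prod_type, ite_mul]
  refine ⟨((blockDiagonal (eliminationBlock s) * constraintMatrix ℝ c s).submatrix
    (splitRows K N) id).toBlocks₂₁, ?_⟩
  ext ((k | ⟨i, b⟩) | k) (⟨v, b'⟩ | k')
  · refine (hmul 0 (Sum.inl k) _).trans ?_
    fin_cases b' <;> simp [eliminationBlock, constraintMatrix, momentMatrix, mul_comm]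
  · refine (hmul 0 (Sum.inl k) _).trans ?_
    by_cases hk : k = k'
    · subst hk
      simp [eliminationBlock, constraintMatrix, coord, castPair]
      ring
    · simp [eliminationBlock, constraintMatrix, hk]
  · refine (hmul b (Sum.inr i) _).trans ?_
    fin_cases b <;> fin_cases b' <;> simp [eliminationBlock, constraintMatrix, momentMatrix]
  · refine (hmul b (Sum.inr i) _).trans ?_
    simp [constraintMatrix]
  · rfl
  · refine (hmul 1 (Sum.inl k) _).trans ?_
    have h := normSq_ne_zero (hs k)
    by_cases hk : k = k'
    · subst hk
      simp [eliminationBlock, constraintMatrix, coord, castPair]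
      field_simp
      ring
    · simp [eliminationBlock, constraintMatrix, hk]

variable [Fintype V] [Fintype K] [DecidableEq V]

/-- The indexing of the equations of `constraintMap` by its unknowns that an indexing of the rows of
`momentMatrix` by its columns induces. -/
def fullRows (τ : V × Fin 2 ≃ K ⊕ N × Fin 2) : (V × Fin 2) ⊕ K ≃ Fin 2 × (K ⊕ N) :=
  (Equiv.sumCongr τ (Equiv.refl K)).trans (splitRows K N)

theorem natAbs_det_constraintMatrix [Fintype N] {c : K ⊕ N → V → ℤ} {s : K → ℤ × ℤ}
    (hs : ∀ k, s k ≠ 0)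
    (τ : V × Fin 2 ≃ K ⊕ N × Fin 2) :
    ((constraintMatrix ℤ c s).submatrix (fullRows τ) id).det.natAbs =
      ((momentMatrix ℤ c s).submatrix τ id).det.natAbs := by
  have h1 : (constraintMatrix ℝ c s).submatrix (fullRows τ) id =
      ((constraintMatrix ℤ c s).submatrix (fullRows τ) id).map (Int.castRingHom ℝ) := by
    rw [constraintMatrix_eq_map, submatrix_map]
  have h2 : (momentMatrix ℝ c s).submatrix τ id =
      ((momentMatrix ℤ c s).submatrix τ id).map (Int.castRingHom ℝ) := by
    ext q ⟨v, b⟩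
    rcases h : τ q with k | i
    · fin_cases b <;> simp [momentMatrix, h]
    · simp [momentMatrix, h, apply_ite (Int.cast : ℤ → ℝ)]
  obtain ⟨X, hX⟩ := eliminationBlock_mul (c := c) hs
  have h3 : (blockDiagonal (eliminationBlock (N := N) s)).submatrix (fullRows τ) (fullRows τ) *
      (constraintMatrix ℝ c s).submatrix (fullRows τ) id =
      fromBlocks ((momentMatrix ℝ c s).submatrix τ id) 0 X (-1) := by
    rw [submatrix_mul_equiv]
    have := congrArg (fun A => A.submatrix (Equiv.sumCongr τ (Equiv.refl K)) id) hX
    refine Eq.trans this ?_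
    ext (q | k) (q' | k') <;> rfl
  have h4 := congrArg (fun A => |A.det|) h3
  simp only [det_mul, abs_mul, det_submatrix_equiv_self, det_blockDiagonal, Finset.abs_prod,
    abs_det_eliminationBlock hs, Finset.prod_const_one, one_mul, det_fromBlocks_zero₁₂, det_neg,
    det_one, mul_one, abs_pow, abs_neg, abs_one, one_pow] at h4
  rw [h1, h2, ← RingHom.mapMatrix_apply, ← RingHom.mapMatrix_apply, ← RingHom.map_det,
    ← RingHom.map_det] at h4
  simp only [eq_intCast, ← Int.cast_abs, Int.abs_eq_natAbs] at h4
  exact_mod_cast h4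

/-- The index of the image of an integral square matrix. -/
theorem index_range_mulVec {ι : Type*} [Fintype ι] [DecidableEq ι] (A : Matrix ι ι ℤ)
    (hA : A.det ≠ 0) : (A.mulVecLin.range.toAddSubgroup).index = A.det.natAbs := by
  have hinj : Function.Injective A.mulVecLin := by
    rw [← LinearMap.ker_eq_bot, LinearMap.ker_eq_bot']
    intro v hv
    exact eq_zero_of_mulVec_eq_zero hA hv
  have h := Submodule.natAbs_det_equiv A.mulVecLin.range (LinearEquiv.ofInjective _ hinj)
  have h' : (A.mulVecLin.range.subtype ∘ₗ
      AddMonoidHom.toIntLinearMap ((LinearEquiv.ofInjective _ hinj :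
        (ι → ℤ) ≃ₗ[ℤ] A.mulVecLin.range) : (ι → ℤ) →+ A.mulVecLin.range)) = A.mulVecLin := by
    ext; rfl
  rw [h'] at h
  rw [← toLin'_apply', LinearMap.det_toLin'] at h
  exact h.symm

theorem index_range_constraintMap [Fintype N] {c : K ⊕ N → V → ℤ} {s : K → ℤ × ℤ}
    (hs : ∀ k, s k ≠ 0)
    (τ : V × Fin 2 ≃ K ⊕ N × Fin 2) (hdet : ((momentMatrix ℤ c s).submatrix τ id).det ≠ 0) :
    (constraintMap ℤ c s).range.index = ((momentMatrix ℤ c s).submatrix τ id).det.natAbs := by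
  have hd := natAbs_det_constraintMatrix (c := c) hs τ
  have hd' : ((constraintMatrix ℤ c s).submatrix (fullRows τ) id).det ≠ 0 := by
    rw [← Int.natAbs_ne_zero, hd]
    exact Int.natAbs_ne_zero.2 hdet
  rw [← hd, ← index_range_mulVec _ hd']
  let θ : (K ⊕ N → ℤ × ℤ) ≃+ ((V × Fin 2) ⊕ K → ℤ) := (rowCoord ℤ _).trans
    { Equiv.arrowCongr (fullRows τ).symm (Equiv.refl ℤ) with map_add' := fun _ _ => rfl }
  have hθ : ∀ y, θ (constraintMap ℤ c s y) =
      (constraintMatrix ℤ c s).submatrix (fullRows τ) id *ᵥ colCoord ℤ V K y := by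
    intro y
    funext q
    exact (congrFun (constraintMatrix_mulVec ℤ c s y) (fullRows τ q)).symm
  rw [← AddSubgroup.index_map_equiv _ θ]
  congr 1
  ext z
  constructor
  · rintro ⟨_, ⟨y, rfl⟩, rfl⟩
    exact ⟨_, (hθ y).symm⟩
  · rintro ⟨y, rfl⟩
    exact ⟨_, ⟨(colCoord ℤ V K).symm y, rfl⟩, by simpa using hθ ((colCoord ℤ V K).symm y)⟩

/-- A real square system that can be solved for all right hand sides is injective, so that its
determinant does not vanish. -/
theorem det_constraintMatrix_ne_zero {c : K ⊕ N → V → ℤ} {s : K → ℤ × ℤ}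
    (τ : V × Fin 2 ≃ K ⊕ N × Fin 2) (hsurj : Function.Surjective (constraintMap ℝ c s)) :
    ((constraintMatrix ℝ c s).submatrix (fullRows τ) id).det ≠ 0 := by
  have h : Function.Surjective ((constraintMatrix ℝ c s).submatrix (fullRows τ) id).mulVec := by
    intro z
    obtain ⟨y, hy⟩ := hsurj ((rowCoord ℝ _).symm (z ∘ (fullRows τ).symm))
    refine ⟨colCoord ℝ V K y, ?_⟩
    funext q
    have := congrFun (constraintMatrix_mulVec ℝ c s y) (fullRows τ q)
    rw [hy] at this
    exact this.trans (by simp)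
  rw [mulVec_surjective_iff_isUnit, isUnit_iff_isUnit_det] at h
  exact h.ne_zero

theorem constraintMap_injective_of_surjective {c : K ⊕ N → V → ℤ} {s : K → ℤ × ℤ}
    (τ : V × Fin 2 ≃ K ⊕ N × Fin 2) (hsurj : Function.Surjective (constraintMap ℝ c s)) :
    Function.Injective (constraintMap ℝ c s) := by
  rw [injective_iff_map_eq_zero]
  intro y hy
  have h : (constraintMatrix ℝ c s).submatrix (fullRows τ) id *ᵥ colCoord ℝ V K y = 0 := by
    funext q
    have := congrFun (constraintMatrix_mulVec ℝ c s y) (fullRows τ q)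
    rw [hy, map_zero] at this
    exact this
  have := eq_zero_of_mulVec_eq_zero (det_constraintMatrix_ne_zero τ hsurj) h
  simpa using this

/-- For a square system that can be solved over the reals, the equations can be distributed to
coordinates of the planar unknowns that they involve. -/
theorem exists_assignment [Fintype N] {c : K ⊕ N → V → ℤ} {s : K → ℤ × ℤ}
    (τ₀ : V × Fin 2 ≃ K ⊕ N × Fin 2) (hsurj : Function.Surjective (constraintMap ℝ c s)) :
    ∃ τ : V × Fin 2 ≃ K ⊕ N × Fin 2, ((momentMatrix ℤ c s).submatrix τ id).det ≠ 0 ∧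
      ∀ p, momentMatrix ℤ c s (τ p) p ≠ 0 := by
  have hs := slope_ne_zero_of_injective (constraintMap_injective_of_surjective τ₀ hsurj)
  have h0 : ∀ τ : V × Fin 2 ≃ K ⊕ N × Fin 2, ((momentMatrix ℤ c s).submatrix τ id).det ≠ 0 := by
    intro τ h
    have h1 := natAbs_det_constraintMatrix (c := c) hs τ
    rw [h, Int.natAbs_zero, Int.natAbs_eq_zero] at h1
    apply det_constraintMatrix_ne_zero τ hsurj
    rw [constraintMatrix_eq_map, submatrix_map, ← RingHom.mapMatrix_apply, ← RingHom.map_det, h1,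
      map_zero]
  have h1 := h0 τ₀
  rw [det_apply] at h1
  obtain ⟨σ, -, hσ⟩ := Finset.exists_ne_zero_of_sum_ne_zero h1
  refine ⟨σ.trans τ₀, h0 _, fun p hp => hσ ?_⟩
  rw [Finset.prod_eq_zero (Finset.mem_univ p) (by simpa using hp), smul_zero]

end LinearSystem

/-! ### Cuts of trees -/

/-- Removing an edge `ab` from an acyclic graph separates `b` from `a`. -/
theorem exists_cut {V : Type*} {G : SimpleGraph V} (hG : G.IsAcyclic) {a b : V} (hab : G.Adj a b) :
    ∃ A : Set V, b ∈ A ∧ a ∉ A ∧ ∀ x y, G.Adj x y → s(x, y) ≠ s(a, b) → (x ∈ A ↔ y ∈ A) := by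
  have hbr := SimpleGraph.isAcyclic_iff_forall_adj_isBridge.1 hG hab
  rw [SimpleGraph.isBridge_iff] at hbr
  refine ⟨{v | (G.deleteEdges {s(a, b)}).Reachable b v}, SimpleGraph.Reachable.refl b,
    fun h => hbr (SimpleGraph.Reachable.symm h), fun x y hxy hne => ?_⟩
  have hxy' : (G.deleteEdges {s(a, b)}).Adj x y := by
    rw [SimpleGraph.deleteEdges_adj]
    exact ⟨hxy, hne⟩
  exact ⟨fun h => SimpleGraph.Reachable.trans h hxy'.reachable,
    fun h => SimpleGraph.Reachable.trans h hxy'.symm.reachable⟩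

namespace CombType

variable {d n : ℕ} (Γ : CombType d n)

/-- The first extremity of a bounded edge, for an arbitrary orientation. -/
noncomputable def src (e : Γ.graph.edgeSet) : Γ.V := (Quot.out e.1).1

/-- The second extremity of a bounded edge, for an arbitrary orientation. -/
noncomputable def tgt (e : Γ.graph.edgeSet) : Γ.V := (Quot.out e.1).2

theorem mk_src_tgt (e : Γ.graph.edgeSet) : s(Γ.src e, Γ.tgt e) = e.1 := Quot.out_eq e.1

theorem adj_src_tgt (e : Γ.graph.edgeSet) : Γ.graph.Adj (Γ.src e) (Γ.tgt e) := by
  have := e.2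
  rwa [← Γ.mk_src_tgt e, SimpleGraph.mem_edgeSet] at this

/-- The slope of a bounded edge, for the orientation from `src` to `tgt`. -/
noncomputable def edgeSlope (e : Γ.graph.edgeSet) : ℤ × ℤ := Γ.slope (Γ.src e) (Γ.tgt e)

theorem src_tgt_cases {v w : Γ.V} (h : Γ.graph.Adj v w) :
    (Γ.src ⟨s(v, w), h⟩ = v ∧ Γ.tgt ⟨s(v, w), h⟩ = w) ∨
      (Γ.src ⟨s(v, w), h⟩ = w ∧ Γ.tgt ⟨s(v, w), h⟩ = v) := by
  have := Γ.mk_src_tgt ⟨s(v, w), h⟩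
  simpa using this

/-- An equation of the form "difference equals multiple of the slope" may be checked on the chosen
orientations. -/
theorem forall_adj_iff {R : Type*} [CommRing R] (x : Γ.V → R × R) (l : Γ.graph.edgeSet → R) :
    (∀ v w (h : Γ.graph.Adj v w), x w - x v = l ⟨s(v, w), h⟩ • castPair R (Γ.slope v w)) ↔
      ∀ e, x (Γ.tgt e) - x (Γ.src e) = l e • castPair R (Γ.edgeSlope e) := by
  constructor
  · intro H e
    have h := H _ _ (Γ.adj_src_tgt e)
    have he : (⟨s(Γ.src e, Γ.tgt e), Γ.adj_src_tgt e⟩ : Γ.graph.edgeSet) = e :=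
      Subtype.ext (Γ.mk_src_tgt e)
    rw [he] at h
    exact h
  · intro H v w h
    have h1 := H ⟨s(v, w), h⟩
    rcases Γ.src_tgt_cases h with ⟨h2, h3⟩ | ⟨h2, h3⟩
    · rw [edgeSlope, h2, h3] at h1
      exact h1
    · rw [edgeSlope, h2, h3, Γ.slope_symm v w h] at h1
      rw [← neg_sub, h1, ← smul_neg]
      congr 1
      ext <;> simp [castPair]

/-- On a tree, differences along the edges can be prescribed. -/
theorem exists_differences {R : Type*} [CommRing R] (b : Γ.graph.edgeSet → R × R) :
    ∃ x : Γ.V → R × R, ∀ e, x (Γ.tgt e) - x (Γ.src e) = b e := by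
  classical
  -- Adding `b e` on the side of `tgt e` changes the difference along `e` only.
  choose A hA1 hA2 hA3 using fun e => exists_cut Γ.isTree.isAcyclic (Γ.adj_src_tgt e)
  refine ⟨fun v => ∑ e, if v ∈ A e then b e else 0, fun e => ?_⟩
  rw [← Finset.sum_sub_distrib, Finset.sum_eq_single e]
  · simp [hA1, hA2]
  · intro f _ hf
    have : s(Γ.src e, Γ.tgt e) ≠ s(Γ.src f, Γ.tgt f) := by
      rw [mk_src_tgt, mk_src_tgt]
      exact fun h => hf (Subtype.ext h.symm)
    simp [hA3 f _ _ (Γ.adj_src_tgt e) this]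
  · simp

/-- By balancing, the slope of a bounded edge is the sum of the slopes of the ends behind it. -/
theorem exists_slope_eq_sum {a b : Γ.V} (hab : Γ.graph.Adj a b) :
    ∃ F : Finset (Fin 3 × Fin d), Γ.slope a b = ∑ e ∈ F, dir e.1 := by
  classical
  obtain ⟨A, hb, ha, hA⟩ := exists_cut Γ.isTree.isAcyclic hab
  refine ⟨Finset.univ.filter fun e => Γ.endFoot e ∈ A, ?_⟩
  -- Balancing is summed over the vertices behind the edge `ab`: all other edges cancel.
  let φ : Γ.V → ℤ := fun v => if v ∈ A then 1 else 0
  let f : Γ.V → Γ.V → ℤ × ℤ := fun v w => if Γ.graph.Adj v w then Γ.slope v w else 0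
  have hf : ∀ v w, f w v = -f v w := by
    intro v w
    by_cases h : Γ.graph.Adj v w
    · simp [f, h, h.symm, Γ.slope_symm v w h]
    · have h' : ¬ Γ.graph.Adj w v := fun h' => h h'.symm
      simp [f, h, h']
  have hne : a ≠ b := hab.ne
  have hT : ∑ v, ∑ w, φ v • f v w = -Γ.slope a b := by
    have h1 : ∑ v, ∑ w, φ v • f v w = -∑ v, ∑ w, φ w • f v w := by
      rw [Finset.sum_comm, ← Finset.sum_neg_distrib]
      refine Finset.sum_congr rfl fun v _ => ?_
      rw [← Finset.sum_neg_distrib]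
      refine Finset.sum_congr rfl fun w _ => ?_
      rw [hf v w, smul_neg]
    have h2 : ∑ v, ∑ w, (φ v - φ w) • f v w = -(2 : ℤ) • Γ.slope a b := by
      have h3 : ∀ v w, (φ v - φ w) • f v w =
          (if v = a then (if w = b then -Γ.slope a b else 0) else 0) +
            (if v = b then (if w = a then -Γ.slope a b else 0) else 0) := by
        intro v w
        by_cases h4 : v = a ∧ w = b
        · obtain ⟨rfl, rfl⟩ := h4
          simp [φ, f, ha, hb, hab, hne]
        by_cases h5 : v = b ∧ w = a
        · obtain ⟨rfl, rfl⟩ := h5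
          simp [φ, f, ha, hb, hab.symm, hne.symm, Γ.slope_symm _ _ hab]
        have h6 : (φ v - φ w) • f v w = 0 := by
          by_cases h7 : Γ.graph.Adj v w
          · have h8 : s(v, w) ≠ s(a, b) := by
              intro h9
              rcases Sym2.eq_iff.1 h9 with h9 | h9
              exacts [h4 h9, h5 h9]
            simp [φ, hA v w h7 h8]
          · simp [f, h7]
        rw [h6]
        have h7 : ∀ {p q : Prop} [Decidable p] [Decidable q] (c : ℤ × ℤ), ¬(p ∧ q) →
            (if p then (if q then c else 0) else 0) = 0 := by
          intro p q _ _ c hpq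
          split_ifs with hp hq
          exacts [absurd ⟨hp, hq⟩ hpq, rfl, rfl]
        rw [h7 _ h4, h7 _ h5, add_zero]
      simp only [h3, Finset.sum_add_distrib]
      simp only [Finset.sum_ite_eq', Finset.mem_univ, if_true, Finset.sum_ite_irrel,
        Finset.sum_const_zero]
      rw [neg_smul, two_smul, neg_add]
    have h3 : (2 : ℤ) • ∑ v, ∑ w, φ v • f v w = (2 : ℤ) • -Γ.slope a b := by
      rw [smul_neg, ← neg_smul, ← h2, two_smul]
      nth_rewrite 2 [h1]
      simp only [sub_smul, Finset.sum_sub_distrib]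
      abel
    exact smul_right_injective _ two_ne_zero h3
  have h0 : ∑ v, φ v • (∑ w ∈ Γ.graph.neighborFinset v, Γ.slope v w +
      ∑ e with Γ.endFoot e = v, dir e.1) = 0 := by
    simp [Γ.balanced]
  have h1 : ∀ v, ∑ w ∈ Γ.graph.neighborFinset v, Γ.slope v w = ∑ w, f v w := by
    intro v
    rw [SimpleGraph.neighborFinset_eq_filter, Finset.sum_filter]
  have h2 : ∑ v, φ v • ∑ e with Γ.endFoot e = v, dir e.1 =
      ∑ e with Γ.endFoot e ∈ A, dir e.1 := by
    rw [Finset.sum_filter]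
    simp only [Finset.smul_sum, Finset.sum_filter]
    rw [Finset.sum_comm]
    refine Finset.sum_congr rfl fun e _ => ?_
    simp [φ]
  simp only [smul_add, Finset.sum_add_distrib, h1,
    Finset.smul_sum (r := φ _) (f := fun w => f _ w)] at h0
  rw [hT, h2] at h0
  rw [← sub_eq_zero, ← neg_eq_zero, ← h0]
  abel

end CombType

/-! ### The system of equations of a tropical curve -/

section System

variable {V E : Type*} [DecidableEq V] {n : ℕ}

/-- The planar forms of a curve with point conditions: the difference of the extremities of every
edge `e` (at `some e`), the last marked point (at `none`) and the other marked points. -/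
def incidence (src tgt : E → V) (foot : Fin (n + 1) → V) : Option E ⊕ Fin n → V → ℤ :=
  Sum.elim
    (fun k => k.elim (fun v => if v = foot (Fin.last n) then 1 else 0)
      fun e v => (if v = tgt e then 1 else 0) - if v = src e then 1 else 0)
    fun i v => if v = foot i.castSucc then 1 else 0

/-- The slopes of the edges and, at `none`, the direction of the line. -/
def slopes (s : E → ℤ × ℤ) (u : ℤ × ℤ) : Option E → ℤ × ℤ := fun k => k.elim u s

variable [Fintype V] (R : Type*) [CommRing R] (src tgt : E → V) (foot : Fin (n + 1) → V)
  (s : E → ℤ × ℤ) (u : ℤ × ℤ) (x : V → R × R) (l : Option E → R)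

theorem constraintMap_some (e : E) :
    constraintMap R (incidence src tgt foot) (slopes s u) (x, l) (Sum.inl (some e)) =
      x (tgt e) - x (src e) - l (some e) • castPair R (s e) := by
  simp [constraintMap, incidence, slopes, sub_smul, Finset.sum_sub_distrib, ite_smul,
    apply_ite (Int.cast : ℤ → R)]

theorem constraintMap_none :
    constraintMap R (incidence src tgt foot) (slopes s u) (x, l) (Sum.inl none) =
      x (foot (Fin.last n)) - l none • castPair R u := by
  simp [constraintMap, incidence, slopes, ite_smul, apply_ite (Int.cast : ℤ → R)]

theorem constraintMap_inr (i : Fin n) :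
    constraintMap R (incidence src tgt foot) (slopes s u) (x, l) (Sum.inr i) =
      x (foot i.castSucc) := by
  simp [constraintMap, incidence, ite_smul, apply_ite (Int.cast : ℤ → R)]

end System

/-- The conditions `(P, Q)` for which the linear span of the cone of curves with the given edges,
slopes and marked points contains a curve through the `P i` whose last marked point lies on the line
through `Q` of direction `u`. If `z = some k`, the scalar number `k` is required to vanish: for
`k = some e` it is the length of the edge `e`, and for `k = none` the position on the line. -/
def solutionSpace {V E : Type*} {n : ℕ} (src tgt : E → V) (foot : Fin (n + 1) → V)
    (s : E → ℤ × ℤ) (u : ℤ × ℤ) (z : Option (Option E)) :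
    Submodule ℝ ((Fin n → ℝ × ℝ) × (ℝ × ℝ)) where
  carrier := {p | ∃ (x : V → ℝ × ℝ) (l : Option E → ℝ),
    (∀ e, x (tgt e) - x (src e) = l (some e) • castPair ℝ (s e)) ∧
    x (foot (Fin.last n)) - l none • castPair ℝ u = p.2 ∧
    (∀ i : Fin n, x (foot i.castSucc) = p.1 i) ∧ ∀ k, z = some k → l k = 0}
  zero_mem' := ⟨0, 0, by simp, by simp, by simp, by simp⟩
  add_mem' := by
    rintro p q ⟨x, l, h1, h2, h3, h4⟩ ⟨x', l', h1', h2', h3', h4'⟩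
    refine ⟨x + x', l + l', fun e => ?_, ?_, fun i => ?_, fun k hk => ?_⟩
    · simp only [Pi.add_apply, add_smul, ← h1, ← h1']
      abel
    · simp only [Pi.add_apply, add_smul, Prod.snd_add, ← h2, ← h2']
      abel
    · simp [h3, h3']
    · simp [h4 k hk, h4' k hk]
  smul_mem' := by
    rintro a p ⟨x, l, h1, h2, h3, h4⟩
    refine ⟨a • x, a • l, fun e => ?_, ?_, fun i => ?_, fun k hk => ?_⟩
    · simp only [Pi.smul_apply, ← smul_sub, h1, smul_eq_mul, mul_smul]
    · simp only [Pi.smul_apply, Prod.smul_snd, ← h2, smul_sub, smul_eq_mul, mul_smul]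
    · simp [h3]
    · simp [h4 k hk]

theorem solutionSpace_le_of_equiv {V E V' E' : Type*} {n : ℕ} (eV : V ≃ V') (eE : E ≃ E')
    {src tgt : E → V} {src' tgt' : E' → V'} {foot : Fin (n + 1) → V} {foot' : Fin (n + 1) → V'}
    {s : E → ℤ × ℤ} {s' : E' → ℤ × ℤ} (u : ℤ × ℤ) {z : Option (Option E)}
    {z' : Option (Option E')} (hsrc : ∀ e, src' (eE e) = eV (src e))
    (htgt : ∀ e, tgt' (eE e) = eV (tgt e)) (hfoot : ∀ i, foot' i = eV (foot i))
    (hs : ∀ e, s' (eE e) = s e) (hz : z' = z.map (Option.map eE)) :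
    solutionSpace src tgt foot s u z ≤ solutionSpace src' tgt' foot' s' u z' := by
  rintro p ⟨x, l, h1, h2, h3, h4⟩
  refine ⟨x ∘ eV.symm, fun k => l (k.map eE.symm), fun e => ?_, ?_, fun i => ?_, fun k hk => ?_⟩
  · obtain ⟨e, rfl⟩ := eE.surjective e
    simp [hsrc, htgt, hs, h1]
  · simp [hfoot, h2]
  · simp [hfoot, h3]
  · apply h4
    subst hz
    rcases z with _ | _ | e <;> rcases k with _ | k <;> simp_all
    simp [← hk]

/-- The solution spaces occur, up to the names of the vertices and of the edges, among finitely
many. -/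
theorem solutionSpace_reindex {V E V' E' : Type*} {n : ℕ} (eV : V ≃ V') (eE : E ≃ E')
    (src tgt : E → V) (foot : Fin (n + 1) → V) (s : E → ℤ × ℤ) (u : ℤ × ℤ)
    (z : Option (Option E)) :
    solutionSpace (eV ∘ src ∘ eE.symm) (eV ∘ tgt ∘ eE.symm) (eV ∘ foot) (s ∘ eE.symm) u
      (z.map (Option.map eE)) = solutionSpace src tgt foot s u z := by
  apply le_antisymm
  · refine solutionSpace_le_of_equiv eV.symm eE.symm u ?_ ?_ ?_ ?_ ?_ <;> intros <;> simp
  · refine solutionSpace_le_of_equiv eV eE u ?_ ?_ ?_ ?_ rfl <;> intros <;> simp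

namespace CombType

variable {d n : ℕ} (Γ : CombType d n)

theorem card_edgeSet_add_one : Fintype.card Γ.graph.edgeSet + 1 = Fintype.card Γ.V := by
  rw [← Γ.isTree.card_edgeFinset, SimpleGraph.edgeFinset_card]

theorem card_vertices {k : ℕ} (hn : n + k + 1 = 3 * d) (hΓ : Γ.IsPsiType (lastPsi n k)) :
    Fintype.card Γ.V = 2 * n := by
  have h1 : ∑ v, Γ.valency v = 2 * Fintype.card Γ.graph.edgeSet + 3 * d + (n + 1) := by
    have h2 : ∑ v, (Finset.univ.filter fun e => Γ.endFoot e = v).card = 3 * d := by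
      rw [← Finset.card_eq_sum_card_fiberwise (fun _ _ => Finset.mem_univ _)]
      simp
    have h3 : ∑ v, (Finset.univ.filter fun i => Γ.markFoot i = v).card = n + 1 := by
      rw [← Finset.card_eq_sum_card_fiberwise (fun _ _ => Finset.mem_univ _)]
      simp
    simp only [valency, Finset.sum_add_distrib, h2, h3, SimpleGraph.sum_degrees_eq_twice_card_edges,
      SimpleGraph.edgeFinset_card]
  have h2 : ∑ v, Γ.valency v = 3 * Fintype.card Γ.V + k := by
    rw [Finset.sum_congr rfl fun v _ => hΓ v, Finset.sum_add_distrib]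
    simp only [Finset.sum_const, Finset.card_univ, smul_eq_mul, Finset.sum_filter]
    rw [Finset.sum_comm]
    simp [lastPsi, mul_comm]
  have h3 := Γ.card_edgeSet_add_one
  omega

/-- The numbers of equations and of unknowns agree. -/
theorem nonempty_rows_equiv {k : ℕ} (hn : n + k + 1 = 3 * d) (hΓ : Γ.IsPsiType (lastPsi n k)) :
    Nonempty (Γ.V × Fin 2 ≃ Option Γ.graph.edgeSet ⊕ Fin n × Fin 2) := by
  rw [← Fintype.card_eq]
  have h1 := Γ.card_edgeSet_add_one
  have h2 := Γ.card_vertices hn hΓ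
  simp only [Fintype.card_prod, Fintype.card_sum, Fintype.card_option, Fintype.card_fin]
  omega

/-- The coefficients of the system of equations of the curves of type `Γ`. -/
noncomputable abbrev incidence : Option Γ.graph.edgeSet ⊕ Fin n → Γ.V → ℤ :=
  TropDesc.incidence Γ.src Γ.tgt Γ.markFoot

/-- The slopes of the system of equations of the curves of type `Γ`, for a line of direction `u`. -/
noncomputable abbrev slopes (u : ℤ × ℤ) : Option Γ.graph.edgeSet → ℤ × ℤ :=
  TropDesc.slopes Γ.edgeSlope u

/-- If the curves of type `Γ` meet all conditions, then the system of equations can be solved for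
arbitrary right hand sides, since differences along the edges can be prescribed. -/
theorem exists_constraintMap_eq {u : ℤ × ℤ} {z : Option (Option Γ.graph.edgeSet)}
    (htop : solutionSpace Γ.src Γ.tgt Γ.markFoot Γ.edgeSlope u z = ⊤)
    (b : Option Γ.graph.edgeSet ⊕ Fin n → ℝ × ℝ) :
    ∃ y, constraintMap ℝ Γ.incidence (Γ.slopes u) y = b ∧ ∀ k, z = some k → y.2 k = 0 := by
  obtain ⟨x₀, hx₀⟩ := Γ.exists_differences fun e => b (Sum.inl (some e))
  have hmem : ((fun i => b (Sum.inr i) - x₀ (Γ.markFoot i.castSucc),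
      b (Sum.inl none) - x₀ (Γ.markFoot (Fin.last n))) : (Fin n → ℝ × ℝ) × (ℝ × ℝ)) ∈
      solutionSpace Γ.src Γ.tgt Γ.markFoot Γ.edgeSlope u z := by
    rw [htop]
    trivial
  obtain ⟨x, l, h1, h2, h3, h4⟩ := hmem
  refine ⟨(x₀ + x, l), ?_, h4⟩
  funext o
  rcases o with (_ | e) | i
  · rw [constraintMap_none, Pi.add_apply, add_sub_assoc, h2]
    simp
  · rw [constraintMap_some, Pi.add_apply, Pi.add_apply, ← h1, ← hx₀]
    abel
  · rw [constraintMap_inr, Pi.add_apply, h3]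
    simp

/-- A square system cannot be solved for all right hand sides with one unknown set to zero. -/
theorem solutionSpace_ne_top {u : ℤ × ℤ}
    (hinj : Function.Injective (constraintMap ℝ Γ.incidence (Γ.slopes u)))
    (k : Option Γ.graph.edgeSet) :
    solutionSpace Γ.src Γ.tgt Γ.markFoot Γ.edgeSlope u (some k) ≠ ⊤ := by
  intro htop
  obtain ⟨y, hy, hk⟩ := Γ.exists_constraintMap_eq htop
    (constraintMap ℝ Γ.incidence (Γ.slopes u) (0, Pi.single k 1))
  have h := hk k rfl
  rw [hinj hy] at h
  simp at h

end CombType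

/-! ### The exceptional subspaces -/

/-- The proper subspaces among the solution spaces, for all possible names of the vertices and edges
of a combinatorial type and all possible slopes. -/
noncomputable def exceptionalSubspaces (d n : ℕ) :
    Finset (Submodule ℝ ((Fin n → ℝ × ℝ) × (ℝ × ℝ))) :=
  haveI := Classical.decEq (Submodule ℝ ((Fin n → ℝ × ℝ) × (ℝ × ℝ)))
  (Set.finite_range fun q : (Fin (2 * n - 1) → Fin (2 * n)) × (Fin (2 * n - 1) → Fin (2 * n)) ×
      (Fin (n + 1) → Fin (2 * n)) × (Fin (2 * n - 1) → Finset (Fin 3 × Fin d)) × Fin 3 ×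
      Option (Option (Fin (2 * n - 1))) =>
    solutionSpace q.1 q.2.1 q.2.2.1 (fun e => ∑ a ∈ q.2.2.2.1 e, dir a.1) (dir q.2.2.2.2.1)
      q.2.2.2.2.2).toFinset.erase ⊤

theorem CombType.solutionSpace_mem_exceptional {d n k : ℕ} (hn : n + k + 1 = 3 * d)
    (Γ : CombType d n) (hΓ : Γ.IsPsiType (lastPsi n k)) (j : Fin 3)
    (z : Option (Option Γ.graph.edgeSet))
    (hne : solutionSpace Γ.src Γ.tgt Γ.markFoot Γ.edgeSlope (dir j) z ≠ ⊤) :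
    solutionSpace Γ.src Γ.tgt Γ.markFoot Γ.edgeSlope (dir j) z ∈ exceptionalSubspaces d n := by
  classical
  have hV := Γ.card_vertices hn hΓ
  have hE := Γ.card_edgeSet_add_one
  let eV : Γ.V ≃ Fin (2 * n) := Fintype.equivFinOfCardEq hV
  let eE : Γ.graph.edgeSet ≃ Fin (2 * n - 1) := Fintype.equivFinOfCardEq (by omega)
  choose F hF using fun e => Γ.exists_slope_eq_sum (Γ.adj_src_tgt e)
  simp only [exceptionalSubspaces, Finset.mem_erase, Set.Finite.mem_toFinset, Set.mem_range]
  refine ⟨hne, ⟨eV ∘ Γ.src ∘ eE.symm, eV ∘ Γ.tgt ∘ eE.symm, eV ∘ Γ.markFoot, F ∘ eE.symm, j,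
    z.map (Option.map eE)⟩, ?_⟩
  rw [← solutionSpace_reindex eV eE]
  congr 1
  funext e
  exact (hF _).symm

/-- The system of equations of a solution with generic conditions is regular, and the solution lies
in the interior of its cone and of a ray of the line. -/
theorem CombType.regular_of_satisfies {d n k : ℕ} (hn : n + k + 1 = 3 * d)
    {P : Fin n → ℝ × ℝ} {Q : ℝ × ℝ} (hPQ : ∀ W ∈ exceptionalSubspaces d n, (P, Q) ∉ W)
    (Γ : CombType d n) (hΓ : Γ.IsPsiType (lastPsi n k)) (h : Γ.Curve)
    (hP : ∀ i : Fin n, h.pos (Γ.markFoot i.castSucc) = P i) {j : Fin 3}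
    (hQ : h.pos Γ.lineVertex ∈ closedRay Q j) :
    (∀ e, 0 < h.len e) ∧ h.pos Γ.lineVertex ∈ openRay Q j ∧
      Function.Surjective (constraintMap ℝ Γ.incidence (Γ.slopes (dir j))) := by
  obtain ⟨t, ht, hQt⟩ := hQ
  have hmem : ∀ z : Option (Option Γ.graph.edgeSet),
      (∀ k, z = some k → k.elim t h.len = 0) →
      solutionSpace Γ.src Γ.tgt Γ.markFoot Γ.edgeSlope (dir j) z = ⊤ := by
    intro z hz
    by_contra hne
    refine hPQ _ (Γ.solutionSpace_mem_exceptional hn hΓ j z hne)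
      ⟨h.pos, fun k => k.elim t h.len, ?_, ?_, hP, hz⟩
    · exact (Γ.forall_adj_iff h.pos h.len).1 h.affine
    · exact sub_eq_iff_eq_add.2 hQt
  have hsurj : Function.Surjective (constraintMap ℝ Γ.incidence (Γ.slopes (dir j))) := by
    intro b
    obtain ⟨y, hy, -⟩ := Γ.exists_constraintMap_eq (hmem none (by simp)) b
    exact ⟨y, hy⟩
  obtain ⟨τ⟩ := Γ.nonempty_rows_equiv hn hΓ
  have hpos : ∀ k : Option Γ.graph.edgeSet, k.elim t h.len ≠ 0 := by
    intro k hk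
    refine Γ.solutionSpace_ne_top (constraintMap_injective_of_surjective τ hsurj) k
      (hmem (some k) ?_)
    rintro k' hk'
    rwa [← Option.some.inj hk']
  exact ⟨fun e => lt_of_le_of_ne (h.len_nonneg e) (hpos (some e)).symm,
    ⟨t, lt_of_le_of_ne ht (hpos none).symm, hQt⟩, hsurj⟩

theorem eq_of_mem_openRay {Q x : ℝ × ℝ} {i j : Fin 3} (hi : x ∈ openRay Q i)
    (hj : x ∈ openRay Q j) : i = j := by
  obtain ⟨t, ht, h1⟩ := hi
  obtain ⟨t', ht', h2⟩ := hj
  rw [h1] at h2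
  have h3 := congrArg Prod.fst h2
  have h4 := congrArg Prod.snd h2
  fin_cases i <;> fin_cases j <;> simp [dir, toReal] at h3 h4 ⊢ <;> linarith

/-! ### The intersection multiplicity as a determinant -/

theorem _root_.AddSubgroup.index_comap_of_forall_exists_sub_mem {G H : Type*} [AddCommGroup G]
    [AddCommGroup H] (f : G →+ H) (K : AddSubgroup H) (hK : ∀ h, ∃ g, h - f g ∈ K) :
    (K.comap f).index = K.index := by
  have h1 : K.comap f = ((QuotientAddGroup.mk' K).comp f).ker := by
    ext g
    simp [AddMonoidHom.mem_ker]
  have h2 : ((QuotientAddGroup.mk' K).comp f).range = ⊤ := by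
    rw [AddMonoidHom.range_eq_top]
    intro q
    obtain ⟨h, rfl⟩ := QuotientAddGroup.mk'_surjective K q
    obtain ⟨g, hg⟩ := hK h
    refine ⟨g, ?_⟩
    rw [← sub_eq_zero, ← neg_eq_zero, neg_sub, AddMonoidHom.comp_apply, ← map_sub]
    exact (QuotientAddGroup.eq_zero_iff _).2 hg
  rw [h1, AddSubgroup.index_ker, h2, AddSubgroup.index]
  exact Nat.card_congr AddSubgroup.topEquiv.toEquiv

namespace CombType

variable {d n : ℕ} (Γ : CombType d n)

theorem psiWeight_lastPsi (k : ℕ) : Γ.psiWeight (lastPsi n k) = 1 := by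
  refine Finset.prod_eq_one fun v _ => ?_
  rw [Nat.multinomial]
  by_cases h : Γ.markFoot (Fin.last n) = v
  · have hm : Fin.last n ∈ Finset.univ.filter fun i => Γ.markFoot i = v := by simpa using h
    rw [Finset.sum_eq_single_of_mem _ hm, Finset.prod_eq_single_of_mem _ hm]
    · simp [lastPsi, Nat.div_self (Nat.factorial_pos k)]
    · intro i _ hi
      simp [lastPsi, hi]
    · intro i _ hi
      simp [lastPsi, hi]
  · have hz : ∀ i ∈ Finset.univ.filter fun i => Γ.markFoot i = v, lastPsi n k i = 0 := by
      intro i hi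
      have : i ≠ Fin.last n := by
        rintro rfl
        exact h (by simpa using hi)
      simp [lastPsi, this]
    rw [Finset.sum_eq_zero hz, Finset.prod_congr rfl fun i hi => by rw [hz i hi]]
    simp

/-- The multiplicity is the index of the image of the integral system of equations: the evaluation
of the tangent lattice and the direction of the line span the part of this image that has no
component at the edges, and every vector can be moved into this part. -/
theorem multiplicity_eq_index (k : ℕ) (u : ℤ × ℤ) :
    Γ.multiplicity (lastPsi n k) u =
      (constraintMap ℤ Γ.incidence (Γ.slopes u)).range.index := by
  have hcast : ∀ a : ℤ × ℤ, castPair ℤ a = a := fun a => by simp [castPair]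
  let ι : (Fin (n + 1) → ℤ × ℤ) →+ (Option Γ.graph.edgeSet ⊕ Fin n → ℤ × ℤ) :=
    { toFun := fun c => Sum.elim (fun k => k.elim (c (Fin.last n)) fun _ => 0)
        fun i => c i.castSucc
      map_zero' := by
        funext o
        rcases o with (_ | e) | i <;> rfl
      map_add' := by
        intro a b
        funext o
        rcases o with (_ | e) | i <;> simp }
  rw [multiplicity, psiWeight_lastPsi, one_mul,
    ← AddSubgroup.index_comap_of_forall_exists_sub_mem ι
      (constraintMap ℤ Γ.incidence (Γ.slopes u)).range]
  · congr 1
    ext c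
    rw [AddSubgroup.mem_sup]
    constructor
    · rintro ⟨_, ⟨⟨x, l⟩, hxl, rfl⟩, _, ⟨t, rfl⟩, rfl⟩
      have hxl' := (Γ.forall_adj_iff x l).1 (by simpa only [hcast] using (id hxl :
        ∀ v w (h : Γ.graph.Adj v w), x w - x v = l ⟨s(v, w), h⟩ • Γ.slope v w))
      -- The line unknown enters the equations with a minus sign.
      refine ⟨(x, fun k => k.elim (-t) l), ?_⟩
      funext o
      rcases o with (_ | e) | i
      · rw [constraintMap_none, hcast]
        simp [ι, evaluation]
      · rw [constraintMap_some]
        simp [ι, hxl']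
      · rw [constraintMap_inr]
        simp [ι, evaluation]
    · rintro ⟨⟨x, l⟩, hxl⟩
      refine ⟨Γ.evaluation (x, fun e => l (some e)), ⟨_, ?_, rfl⟩, _,
        ⟨-l none, rfl⟩, ?_⟩
      · have h : ∀ e, x (Γ.tgt e) - x (Γ.src e) = l (some e) • castPair ℤ (Γ.edgeSlope e) := by
          intro e
          have h1 := congrFun hxl (Sum.inl (some e))
          rw [constraintMap_some] at h1
          exact sub_eq_zero.1 h1
        have h2 := (Γ.forall_adj_iff x fun e => l (some e)).2 h
        simp only [hcast] at h2
        exact h2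
      · funext i
        induction i using Fin.lastCases with
        | last =>
          have h1 := congrFun hxl (Sum.inl none)
          rw [constraintMap_none, hcast] at h1
          simpa [ι, evaluation, sub_eq_add_neg] using h1
        | cast i =>
          have h1 := congrFun hxl (Sum.inr i)
          rw [constraintMap_inr] at h1
          simpa [ι, evaluation, (Fin.castSucc_lt_last i).ne] using h1
  · intro b
    obtain ⟨x, hx⟩ := Γ.exists_differences fun e => b (Sum.inl (some e))
    refine ⟨fun i => Fin.lastCases (b (Sum.inl none) - x (Γ.markFoot (Fin.last n)))
      (fun i => b (Sum.inr i) - x (Γ.markFoot i.castSucc)) i, (x, 0), ?_⟩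
    funext o
    rcases o with (_ | e) | i
    · rw [constraintMap_none]
      simp [ι]
    · rw [constraintMap_some]
      simp [ι, hx]
    · rw [constraintMap_inr]
      simp [ι]

end CombType

namespace CombType

variable {d n : ℕ} {Γ : CombType d n}

/-! ### Flows on a tropical curve -/

/-- An orientation of the bounded edges such that no edge points to one of the first `n` marked
points, exactly one points to the last marked point, and exactly two point to every unmarked
vertex. `arrow v w` says that there is a bounded edge `vw`, and that it is oriented towards `w`. -/
structure IsFlow (Γ : CombType d n) (arrow : Γ.V → Γ.V → Prop) : Prop where
  adj : ∀ {v w}, arrow v w → Γ.graph.Adj v w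
  total : ∀ {v w}, Γ.graph.Adj v w → arrow v w ∨ arrow w v
  asymm : ∀ {v w}, arrow v w → ¬arrow w v
  mark : ∀ (i : Fin n) w, ¬arrow w (Γ.markFoot i.castSucc)
  line : ∃! w, arrow w Γ.lineVertex
  unmarked : ∀ v, Γ.IsUnmarked v → ∃ w₁ w₂, w₁ ≠ w₂ ∧ ∀ w, arrow w v ↔ w = w₁ ∨ w = w₂

/-- The bounded edges (given by their other extremities) and the ends at a vertex. -/
def flags (Γ : CombType d n) (v : Γ.V) : Finset (Γ.V ⊕ (Fin 3 × Fin d)) :=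
  (Γ.graph.neighborFinset v).disjSum (Finset.univ.filter fun e => Γ.endFoot e = v)

theorem mem_flags {v : Γ.V} {a : Γ.V ⊕ (Fin 3 × Fin d)} : a ∈ Γ.flags v ↔ Γ.IsFlag v a := by
  rcases a with w | e <;> simp [flags, IsFlag]

theorem card_flags {v : Γ.V} (hv : Γ.IsUnmarked v) : (Γ.flags v).card = Γ.valency v := by
  have : (Finset.univ.filter fun i => Γ.markFoot i = v) = ∅ := by
    simpa [Finset.filter_eq_empty_iff] using hv
  rw [flags, Finset.card_disjSum, valency, this, Finset.card_empty, add_zero,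
    SimpleGraph.card_neighborFinset_eq_degree]

theorem sum_flagSlope (v : Γ.V) : ∑ a ∈ Γ.flags v, Γ.flagSlope v a = 0 := by
  rw [flags, Finset.sum_disjSum]
  exact Γ.balanced v

theorem valency_of_isUnmarked {κ : Fin (n + 1) → ℕ} (hΓ : Γ.IsPsiType κ) {v : Γ.V}
    (hv : Γ.IsUnmarked v) : Γ.valency v = 3 := by
  have : (Finset.univ.filter fun i => Γ.markFoot i = v) = ∅ := by
    simpa [Finset.filter_eq_empty_iff] using hv
  rw [hΓ v, this, Finset.sum_empty, add_zero]

namespace IsFlow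

variable {arrow : Γ.V → Γ.V → Prop}

/-- A flow has no directed cycles: a directed path that starts with an arrow `vw` stays in the
component of `w` in the complement of the edge `vw`. -/
theorem irrefl (hF : IsFlow Γ arrow) (v : Γ.V) : ¬Relation.TransGen arrow v v := by
  intro h
  obtain ⟨w, hvw, hwv⟩ := Relation.TransGen.head'_iff.1 h
  obtain ⟨A, hw, hv, hA⟩ := exists_cut Γ.isTree.isAcyclic (hF.adj hvw)
  have key : ∀ x, Relation.ReflTransGen arrow w x → x ∈ A := by
    intro x hx
    induction hx with
    | refl => exact hw
    | @tail x y _ hxy ih =>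
      by_cases he : s(x, y) = s(v, w)
      · rcases Sym2.eq_iff.1 he with ⟨rfl, rfl⟩ | ⟨rfl, rfl⟩
        · exact absurd ih hv
        · exact absurd hvw (hF.asymm hxy)
      · exact (hA x y (hF.adj hxy) he).1 ih
  exact hv (key v hwv)

theorem isUnmarked_or (hF : IsFlow Γ arrow) {v w : Γ.V} (h : arrow v w) :
    Γ.IsUnmarked w ∨ w = Γ.lineVertex := by
  by_cases hw : Γ.IsUnmarked w
  · exact Or.inl hw
  · right
    simp only [IsUnmarked, ne_eq, not_forall, not_not] at hw
    obtain ⟨i, rfl⟩ := hw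
    induction i using Fin.lastCases with
    | last => rfl
    | cast i => exact absurd h (hF.mark i v)

/-- At an unmarked vertex, there is exactly one edge or end that does not point to it. -/
theorem existsUnique_out (hF : IsFlow Γ arrow) {κ : Fin (n + 1) → ℕ} (hΓ : Γ.IsPsiType κ) {v : Γ.V}
    (hv : Γ.IsUnmarked v) :
    ∃! a, Γ.IsFlag v a ∧ ∀ w, arrow w v → a ≠ Sum.inl w := by
  obtain ⟨w₁, w₂, hne, hw⟩ := hF.unmarked v hv
  have h1 : Sum.inl w₁ ∈ Γ.flags v := mem_flags.2 (hF.adj ((hw w₁).2 (Or.inl rfl))).symm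
  have h2 : Sum.inl w₂ ∈ Γ.flags v := mem_flags.2 (hF.adj ((hw w₂).2 (Or.inr rfl))).symm
  have hcard : (((Γ.flags v).erase (Sum.inl w₁)).erase (Sum.inl w₂)).card = 1 := by
    rw [Finset.card_erase_of_mem (Finset.mem_erase.2 ⟨by simpa using hne.symm, h2⟩),
      Finset.card_erase_of_mem h1, card_flags hv, valency_of_isUnmarked hΓ hv]
  obtain ⟨a, ha⟩ := Finset.card_eq_one.1 hcard
  have hmem : ∀ b, (Γ.IsFlag v b ∧ ∀ w, arrow w v → b ≠ Sum.inl w) ↔ b = a := by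
    intro b
    rw [← Finset.mem_singleton, ← ha, Finset.mem_erase, Finset.mem_erase, mem_flags]
    constructor
    · rintro ⟨hb, hb'⟩
      exact ⟨hb' _ ((hw w₂).2 (Or.inr rfl)), hb' _ ((hw w₁).2 (Or.inl rfl)), hb⟩
    · rintro ⟨hb2, hb1, hb⟩
      refine ⟨hb, fun w hw' => ?_⟩
      rcases (hw w).1 hw' with rfl | rfl
      exacts [hb1, hb2]
  exact ⟨a, (hmem a).2 rfl, fun b hb => (hmem b).1 hb⟩

/-- Following the flow, every edge is joined to an end or to the edge that points to the last marked
point. -/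
theorem mk_eq_or (hF : IsFlow Γ arrow) {κ : Fin (n + 1) → ℕ} (hΓ : Γ.IsPsiType κ) {w₀ : Γ.V}
    (hw₀ : arrow w₀ Γ.lineVertex) (v w : Γ.V) (hvw : arrow v w) :
    (∃ e, Quot.mk Γ.Joined (Sum.inr e) = Quot.mk Γ.Joined (Sum.inl ⟨s(v, w), hF.adj hvw⟩)) ∨
      Quot.mk Γ.Joined (Sum.inl ⟨s(v, w), hF.adj hvw⟩) =
        Quot.mk Γ.Joined (Sum.inl ⟨s(w₀, Γ.lineVertex), hF.adj hw₀⟩) := by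
  have wf : WellFounded (Function.swap (Relation.TransGen arrow)) := by
    have : IsTrans Γ.V (Function.swap (Relation.TransGen arrow)) :=
      ⟨fun _ _ _ h1 h2 => h2.trans h1⟩
    have : Std.Irrefl (Function.swap (Relation.TransGen arrow)) := ⟨hF.irrefl⟩
    exact Finite.wellFounded_of_trans_of_irrefl _
  induction w using wf.induction generalizing v with
  | _ w ih =>
  rcases hF.isUnmarked_or hvw with hw | rfl
  · obtain ⟨a, ⟨ha, ha'⟩, -⟩ := hF.existsUnique_out hΓ hw
    rcases a with x | e
    · have hwx : arrow w x := by
        rcases hF.total ha with h | h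
        · exact h
        · exact absurd rfl (ha' x h)
      have hj : Quot.mk Γ.Joined (Sum.inl ⟨s(v, w), hF.adj hvw⟩) =
          Quot.mk Γ.Joined (Sum.inl ⟨s(w, x), hF.adj hwx⟩) :=
        Quot.sound ⟨w, hw, by simp [Touches], by simp [Touches]⟩
      rw [hj]
      exact ih x (Relation.TransGen.single hwx) w hwx
    · exact Or.inl ⟨e, Quot.sound ⟨w, hw, ha, by simp [Touches]⟩⟩
  · right
    obtain rfl : v = w₀ := hF.line.unique hvw hw₀
    rfl

/-- The cell is a bounded edge from whose head a directed path leads to the last marked point,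
leaving unmarked vertices only. -/
def FlowsToLine (arrow : Γ.V → Γ.V → Prop) : Γ.Cell → Prop
  | Sum.inl e => ∃ v w, e.1 = s(v, w) ∧ arrow v w ∧
      Relation.ReflTransGen (fun x y => Γ.IsUnmarked x ∧ arrow x y) w Γ.lineVertex
  | Sum.inr _ => False

theorem not_isUnmarked_lineVertex : ¬Γ.IsUnmarked Γ.lineVertex := fun h => h _ rfl

/-- At an unmarked vertex `v`, a cell that points to `v` flows on through the unique cell that leaves
`v`, so that all cells at `v` have the same destination. -/
theorem flowsToLine_iff (hF : IsFlow Γ arrow) {κ : Fin (n + 1) → ℕ} (hΓ : Γ.IsPsiType κ) {v : Γ.V}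
    (hv : Γ.IsUnmarked v) {c : Γ.Cell} (hc : Γ.Touches v c) :
    FlowsToLine arrow c ↔
      Relation.ReflTransGen (fun x y => Γ.IsUnmarked x ∧ arrow x y) v Γ.lineVertex := by
  rcases c with ⟨e, he⟩ | e
  · have hve : v ∈ e := hc
    obtain ⟨w, rfl⟩ := Sym2.mem_iff_exists.1 hve
    rcases hF.total he with hvw | hwv
    · constructor
      · rintro ⟨x, y, hxy, harr, h⟩
        rcases Sym2.eq_iff.1 hxy with ⟨rfl, rfl⟩ | ⟨rfl, rfl⟩
        · exact Relation.ReflTransGen.head ⟨hv, hvw⟩ h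
        · exact absurd hvw (hF.asymm harr)
      · intro h
        rcases Relation.ReflTransGen.cases_head h with h | ⟨x, ⟨-, hvx⟩, hx⟩
        · exact absurd (h ▸ hv) not_isUnmarked_lineVertex
        · have h1 := (hF.existsUnique_out hΓ hv).unique (y₁ := Sum.inl x) (y₂ := Sum.inl w)
            ⟨hF.adj hvx, fun y hy hxy => hF.asymm hvx (by rwa [Sum.inl.inj hxy])⟩
            ⟨hF.adj hvw, fun y hy hxy => hF.asymm hvw (by rwa [Sum.inl.inj hxy])⟩
          rw [Sum.inl.inj h1] at hx
          exact ⟨v, w, rfl, hvw, hx⟩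
    · constructor
      · rintro ⟨x, y, hxy, harr, h⟩
        rcases Sym2.eq_iff.1 hxy with ⟨rfl, rfl⟩ | ⟨rfl, rfl⟩
        · exact absurd hwv (hF.asymm harr)
        · exact h
      · intro h
        exact ⟨w, v, Sym2.eq_swap, hwv, h⟩
  · refine ⟨False.elim, fun h => ?_⟩
    rcases Relation.ReflTransGen.cases_head h with h | ⟨x, ⟨-, hvx⟩, -⟩
    · exact absurd (h ▸ hv) not_isUnmarked_lineVertex
    · have h1 := (hF.existsUnique_out hΓ hv).unique (y₁ := Sum.inl x) (y₂ := Sum.inr e)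
        ⟨hF.adj hvx, fun y hy hxy => hF.asymm hvx (by rwa [Sum.inl.inj hxy])⟩
        ⟨hc, fun y _ h => nomatch h⟩
      exact nomatch h1

/-- Flowing to the last marked point is a property of components. -/
theorem flowsToLine_congr (hF : IsFlow Γ arrow) {κ : Fin (n + 1) → ℕ} (hΓ : Γ.IsPsiType κ)
    {c c' : Γ.Cell} (h : Quot.mk Γ.Joined c = Quot.mk Γ.Joined c') :
    FlowsToLine arrow c ↔ FlowsToLine arrow c' := by
  have h1 : ∀ a b, Γ.Joined a b → FlowsToLine arrow a = FlowsToLine arrow b := by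
    rintro a b ⟨v, hv, ha, hb⟩
    rw [hF.flowsToLine_iff hΓ hv ha, hF.flowsToLine_iff hΓ hv hb]
  exact iff_of_eq (congrArg (Quot.lift (FlowsToLine arrow) h1) h)

theorem flowsToLine_of_arrow (hF : IsFlow Γ arrow) {w₀ : Γ.V} (hw₀ : arrow w₀ Γ.lineVertex) :
    FlowsToLine arrow (Sum.inl ⟨s(w₀, Γ.lineVertex), hF.adj hw₀⟩) :=
  ⟨_, _, rfl, hw₀, Relation.ReflTransGen.refl⟩

theorem isBounded_iff (hF : IsFlow Γ arrow) {κ : Fin (n + 1) → ℕ} (hΓ : Γ.IsPsiType κ) {w₀ : Γ.V}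
    (hw₀ : arrow w₀ Γ.lineVertex) (c : Γ.Component) :
    c.IsBounded ↔ c = Quot.mk Γ.Joined (Sum.inl ⟨s(w₀, Γ.lineVertex), hF.adj hw₀⟩) := by
  constructor
  · intro hc
    induction c using Quot.ind with
    | mk c =>
    rcases c with ⟨e, he⟩ | e
    · induction e using Sym2.ind with
      | _ v w =>
      rcases hF.total he with h | h
      · rcases hF.mk_eq_or hΓ hw₀ v w h with ⟨e, he⟩ | h
        · exact absurd he (hc e)
        · exact h
      · have hs : (⟨s(v, w), he⟩ : Γ.graph.edgeSet) = ⟨s(w, v), hF.adj h⟩ :=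
          Subtype.ext Sym2.eq_swap
        rw [hs] at hc ⊢
        rcases hF.mk_eq_or hΓ hw₀ w v h with ⟨e, he⟩ | h
        · exact absurd he (hc e)
        · exact h
    · exact absurd rfl (hc e)
  · rintro rfl e he
    exact (hF.flowsToLine_congr hΓ he).2 (hF.flowsToLine_of_arrow hw₀)

theorem existsUnique_isBounded (hF : IsFlow Γ arrow) {κ : Fin (n + 1) → ℕ} (hΓ : Γ.IsPsiType κ) :
    ∃! c : Γ.Component, c.IsBounded := by
  obtain ⟨w₀, hw₀, -⟩ := hF.line
  exact ⟨_, (hF.isBounded_iff hΓ hw₀ _).2 rfl, fun c hc => (hF.isBounded_iff hΓ hw₀ c).1 hc⟩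

/-- An edge that leaves the last marked point cannot flow back to it. -/
theorem isBoundedDirection_iff (hF : IsFlow Γ arrow) {κ : Fin (n + 1) → ℕ} (hΓ : Γ.IsPsiType κ)
    (w : Γ.V) : Γ.IsBoundedDirection Γ.lineVertex w ↔ arrow w Γ.lineVertex := by
  constructor
  · rintro ⟨h, hb⟩
    obtain ⟨w₀, hw₀, -⟩ := hF.line
    rcases hF.total h with hlw | hwl
    · exfalso
      have h1 := (hF.isBounded_iff hΓ hw₀ _).1 hb
      obtain ⟨x, y, hxy, harr, hr⟩ :=
        (hF.flowsToLine_congr hΓ h1).2 (hF.flowsToLine_of_arrow hw₀)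
      rcases Sym2.eq_iff.1 hxy with ⟨h2, h3⟩ | ⟨h2, h3⟩
      · subst h3
        exact hF.irrefl _ (Relation.TransGen.head' hlw
          (Relation.ReflTransGen.mono (fun _ _ h => h.2) _ _ hr))
      · rw [← h2, ← h3] at harr
        exact hF.asymm hlw harr
    · exact hwl
  · intro h
    refine ⟨(hF.adj h).symm, (hF.isBounded_iff hΓ h _).2 ?_⟩
    congr 2
    exact Subtype.ext Sym2.eq_swap

end IsFlow

end CombType

/-! ### The determinant of the system of equations -/

/-- If the rows of a matrix are distributed to the points of an acyclic relation, two to each, and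
only involve this point and points below it, then the determinant is the product of the `2 × 2`
determinants at the points. -/
theorem det_eq_prod_of_acyclic {V : Type*} [Fintype V] [DecidableEq V]
    (M : Matrix (V × Fin 2) (V × Fin 2) ℤ) {r : V → V → Prop}
    (hr : ∀ v, ¬Relation.TransGen r v v)
    (hM : ∀ w b v b', M (w, b) (v, b') ≠ 0 → v = w ∨ r v w) :
    M.det = ∏ v, (M (v, 0) (v, 0) * M (v, 1) (v, 1) - M (v, 0) (v, 1) * M (v, 1) (v, 0)) := by
  have hpo : IsPartialOrder V (Relation.ReflTransGen r) :=
    { refl := fun _ => Relation.ReflTransGen.refl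
      trans := fun _ _ _ h1 h2 => h1.trans h2
      antisymm := by
        intro v w h1 h2
        rcases Relation.reflTransGen_iff_eq_or_transGen.1 h1 with h | h
        · exact h.symm
        · exact absurd (h.trans_left h2) (hr v) }
  obtain ⟨le, hle, hsub⟩ := extend_partialOrder (Relation.ReflTransGen r)
  let _ : LinearOrder V :=
    { le := le
      le_refl := hle.refl
      le_trans := hle.trans
      le_antisymm := hle.antisymm
      le_total := hle.total
      toDecidableLE := Classical.decRel _ }
  -- The linear order extends the relation, so that row `(w, b)` only involves points `v ≤ w`.
  have hBT : Mᵀ.BlockTriangular Prod.fst := by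
    rintro ⟨v, b'⟩ ⟨w, b⟩ hwv
    by_contra hne
    have hvw : v ≤ w := by
      rcases hM w b v b' hne with h | h
      · exact h.le
      · exact hsub _ _ (Relation.ReflTransGen.single h)
    exact absurd hvw (not_le.2 hwv)
  rw [← det_transpose, hBT.det_fintype]
  refine Finset.prod_congr rfl fun v _ => ?_
  let ε : Fin 2 ≃ {p : V × Fin 2 // p.1 = v} :=
    { toFun := fun b => ⟨(v, b), rfl⟩
      invFun := fun p => p.1.2
      left_inv := fun _ => rfl
      right_inv := by
        rintro ⟨⟨w, b⟩, rfl⟩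
        rfl }
  rw [← det_submatrix_equiv_self ε, det_fin_two]
  simp only [submatrix_apply, toSquareBlock, toSquareBlockProp, toBlock_apply, transpose_apply, ε,
    Equiv.coe_fn_mk]
  ring

theorem natAbs_det_neg_left (a b : ℤ × ℤ) : (det (-a) b).natAbs = (det a b).natAbs := by
  rw [← Int.natAbs_neg]
  congr 1
  simp only [det, Prod.fst_neg, Prod.snd_neg]
  ring

theorem natAbs_det_comm (a b : ℤ × ℤ) : (det a b).natAbs = (det b a).natAbs := by
  rw [← Int.natAbs_neg]
  congr 1
  simp only [det]
  ring

theorem natAbs_det_neg_right (a b : ℤ × ℤ) : (det a (-b)).natAbs = (det a b).natAbs := by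
  rw [natAbs_det_comm, natAbs_det_neg_left, natAbs_det_comm]

/-- If three planar vectors add up to zero, then any two of them have the same determinant up to
sign. -/
theorem natAbs_det_eq_of_sum_eq_zero {ι : Type*} [DecidableEq ι] {F : Finset ι} (hF : F.card = 3)
    {g : ι → ℤ × ℤ} (hg : ∑ x ∈ F, g x = 0) {a b c e : ι} (ha : a ∈ F) (hb : b ∈ F) (hab : a ≠ b)
    (hc : c ∈ F) (he : e ∈ F) (hce : c ≠ e) :
    (det (g a) (g b)).natAbs = (det (g c) (g e)).natAbs := by
  obtain ⟨x, y, z, hxy, hxz, hyz, rfl⟩ := Finset.card_eq_three.1 hF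
  rw [Finset.sum_insert (by simp [hxy, hxz]), Finset.sum_insert (by simp [hyz]),
    Finset.sum_singleton] at hg
  have hz : g z = -(g x + g y) := by
    rw [eq_neg_iff_add_eq_zero, ← hg]
    abel
  have h1 : (det (g x) (g z)).natAbs = (det (g x) (g y)).natAbs := by
    rw [hz, natAbs_det_neg_right]
    congr 1
    simp only [det, Prod.fst_add, Prod.snd_add]
    ring
  have h2 : (det (g y) (g z)).natAbs = (det (g x) (g y)).natAbs := by
    rw [hz, natAbs_det_neg_right, natAbs_det_comm (g x)]
    congr 1
    simp only [det, Prod.fst_add, Prod.snd_add]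
    ring
  have key : ∀ p ∈ ({x, y, z} : Finset ι), ∀ q ∈ ({x, y, z} : Finset ι), p ≠ q →
      (det (g p) (g q)).natAbs = (det (g x) (g y)).natAbs := by
    intro p hp q hq hpq
    simp only [Finset.mem_insert, Finset.mem_singleton] at hp hq
    rcases hp with rfl | rfl | rfl <;> rcases hq with rfl | rfl | rfl
    exacts [absurd rfl hpq, rfl, h1, natAbs_det_comm _ _, absurd rfl hpq, h2,
      (natAbs_det_comm _ _).trans h1, (natAbs_det_comm _ _).trans h2, absurd rfl hpq]
  rw [key a ha b hb hab, key c hc e he hce]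

namespace CombType

variable {d n : ℕ} {Γ : CombType d n}

theorem edgeSlope_eq_or {v w : Γ.V} (h : Γ.graph.Adj w v) :
    Γ.edgeSlope ⟨s(w, v), h⟩ = Γ.slope v w ∨ Γ.edgeSlope ⟨s(w, v), h⟩ = -Γ.slope v w := by
  rcases Γ.src_tgt_cases h with ⟨h1, h2⟩ | ⟨h1, h2⟩
  · right
    rw [edgeSlope, h1, h2, Γ.slope_symm v w h.symm]
  · left
    rw [edgeSlope, h1, h2]

theorem incidence_some_eq_zero {e : Γ.graph.edgeSet} {v : Γ.V} (hv : v ∉ e.1) :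
    Γ.incidence (Sum.inl (some e)) v = 0 := by
  rw [← Γ.mk_src_tgt e, Sym2.mem_iff, not_or] at hv
  simp [incidence, TropDesc.incidence, hv.1, hv.2]

theorem natAbs_incidence_some {e : Γ.graph.edgeSet} {v : Γ.V} (hv : v ∈ e.1) :
    (Γ.incidence (Sum.inl (some e)) v).natAbs = 1 := by
  rw [← Γ.mk_src_tgt e, Sym2.mem_iff] at hv
  have hne := (Γ.adj_src_tgt e).ne
  rcases hv with rfl | rfl
  · simp [incidence, TropDesc.incidence, hne]
  · simp [incidence, TropDesc.incidence, hne.symm]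

/-- A distribution of the equations to the coordinates of the images of the vertices, such that
every equation involves its coordinate. -/
def IsAssignment (u : ℤ × ℤ) (τ : Γ.V × Fin 2 ≃ Option Γ.graph.edgeSet ⊕ Fin n × Fin 2) : Prop :=
  ∀ p, momentMatrix ℤ Γ.incidence (Γ.slopes u) (τ p) p ≠ 0

/-- An edge is oriented towards the vertex to which its equation is assigned. -/
def assignmentArrow (τ : Γ.V × Fin 2 ≃ Option Γ.graph.edgeSet ⊕ Fin n × Fin 2) (v w : Γ.V) : Prop :=
  ∃ (h : Γ.graph.Adj v w) (b : Fin 2), τ (w, b) = Sum.inl (some ⟨s(v, w), h⟩)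

namespace IsAssignment

variable {u : ℤ × ℤ} {τ : Γ.V × Fin 2 ≃ Option Γ.graph.edgeSet ⊕ Fin n × Fin 2}

theorem mem_of_eq_some (hτ : IsAssignment u τ) {v : Γ.V} {b : Fin 2} {e : Γ.graph.edgeSet}
    (h : τ (v, b) = Sum.inl (some e)) : v ∈ e.1 := by
  by_contra hv
  apply hτ (v, b)
  rw [h]
  simp [momentMatrix, incidence_some_eq_zero hv]

theorem eq_lineVertex_of_eq_none (hτ : IsAssignment u τ) {v : Γ.V} {b : Fin 2}
    (h : τ (v, b) = Sum.inl none) : v = Γ.lineVertex := by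
  by_contra hv
  apply hτ (v, b)
  rw [h]
  have : ¬v = Γ.markFoot (Fin.last n) := hv
  simp [momentMatrix, incidence, TropDesc.incidence, this]

theorem apply_markFoot (hτ : IsAssignment u τ) (i : Fin n) (b : Fin 2) :
    τ (Γ.markFoot i.castSucc, b) = Sum.inr (i, b) := by
  obtain ⟨⟨v, b'⟩, h⟩ := τ.surjective (Sum.inr (i, b))
  have h1 := hτ (v, b')
  rw [h] at h1
  simp only [momentMatrix, incidence, TropDesc.incidence, of_apply, Sum.elim_inr] at h1
  have h2 : b = b' := by
    by_contra hb
    simp [hb] at h1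
  have h3 : v = Γ.markFoot i.castSucc := by
    by_contra hv
    simp [hv] at h1
  rw [← h, h2, h3]

/-- The slots of a vertex other than the first `n` marked points are taken by edges and, at the last
marked point, by the line. -/
theorem exists_eq_inl (hτ : IsAssignment u τ) {v : Γ.V}
    (hv : ∀ i : Fin n, Γ.markFoot i.castSucc ≠ v) (b : Fin 2) : ∃ k, τ (v, b) = Sum.inl k := by
  rcases h : τ (v, b) with k | ⟨i, b'⟩
  · exact ⟨k, rfl⟩
  · rw [← hτ.apply_markFoot i b'] at h
    exact absurd (congrArg Prod.fst (τ.injective h)).symm (hv i)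

theorem exists_eq_some (hτ : IsAssignment u τ) {v : Γ.V} (hv : Γ.IsUnmarked v) (b : Fin 2) :
    ∃ (w : Γ.V) (h : Γ.graph.Adj w v), τ (v, b) = Sum.inl (some ⟨s(w, v), h⟩) := by
  obtain ⟨k, hk⟩ := hτ.exists_eq_inl (fun i => hv _) b
  rcases k with _ | ⟨e, he⟩
  · exact absurd (hτ.eq_lineVertex_of_eq_none hk).symm (hv _)
  · have hve : v ∈ e := hτ.mem_of_eq_some hk
    obtain ⟨w, rfl⟩ := Sym2.mem_iff_exists.1 hve
    refine ⟨w, SimpleGraph.Adj.symm he, ?_⟩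
    rw [hk]
    congr 3
    exact Sym2.eq_swap

theorem lineVertex_ne (hτ : IsAssignment u τ) (i : Fin n) :
    Γ.markFoot i.castSucc ≠ Γ.lineVertex := by
  obtain ⟨⟨v, b⟩, h⟩ := τ.surjective (Sum.inl none)
  obtain rfl := hτ.eq_lineVertex_of_eq_none h
  intro hi
  rw [← hi, hτ.apply_markFoot] at h
  exact absurd h Sum.inr_ne_inl

/-- One slot of the last marked point is taken by the line, the other one by an edge. -/
theorem exists_slots_lineVertex (hτ : IsAssignment u τ) :
    ∃ (b b' : Fin 2) (w : Γ.V) (h : Γ.graph.Adj w Γ.lineVertex), b ≠ b' ∧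
      τ (Γ.lineVertex, b) = Sum.inl none ∧
      τ (Γ.lineVertex, b') = Sum.inl (some ⟨s(w, Γ.lineVertex), h⟩) := by
  obtain ⟨⟨v, b⟩, h⟩ := τ.surjective (Sum.inl none)
  obtain rfl := hτ.eq_lineVertex_of_eq_none h
  obtain ⟨b', hb⟩ : ∃ b' : Fin 2, b ≠ b' := by
    fin_cases b
    exacts [⟨1, by simp⟩, ⟨0, by simp⟩]
  obtain ⟨k, hk⟩ := hτ.exists_eq_inl hτ.lineVertex_ne b'
  rcases k with _ | ⟨e, he⟩
  · rw [← h] at hk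
    exact absurd (congrArg Prod.snd (τ.injective hk)).symm hb
  · have hve : Γ.lineVertex ∈ e := hτ.mem_of_eq_some hk
    obtain ⟨w, rfl⟩ := Sym2.mem_iff_exists.1 hve
    refine ⟨b, b', w, SimpleGraph.Adj.symm he, hb, h, ?_⟩
    rw [hk]
    congr 3
    exact Sym2.eq_swap

theorem eq_of_row_eq {v w w' : Γ.V} {h : Γ.graph.Adj w v} {h' : Γ.graph.Adj w' v}
    (he : (Sum.inl (some ⟨s(w, v), h⟩) : Option Γ.graph.edgeSet ⊕ Fin n × Fin 2) =
      Sum.inl (some ⟨s(w', v), h'⟩)) : w = w' :=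
  Sym2.congr_left.1 (congrArg Subtype.val (Option.some.inj (Sum.inl.inj he)))

theorem eq_of_slots {b b' b'' : Fin 2} (h : b ≠ b') : b'' = b ∨ b'' = b' := by
  omega

theorem isFlow (hτ : IsAssignment u τ) : IsFlow Γ (assignmentArrow τ) where
  adj h := h.1
  total {v w} h := by
    obtain ⟨⟨x, b⟩, hx⟩ := τ.surjective (Sum.inl (some ⟨s(v, w), h⟩))
    rcases Sym2.mem_iff.1 (hτ.mem_of_eq_some hx) with rfl | rfl
    · refine Or.inr ⟨h.symm, b, hx.trans ?_⟩
      congr 3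
      exact Sym2.eq_swap
    · exact Or.inl ⟨h, b, hx⟩
  asymm {v w} := by
    rintro ⟨h, b, hb⟩ ⟨h', b', hb'⟩
    have : τ (w, b) = τ (v, b') := by
      rw [hb, hb']
      congr 3
      exact Sym2.eq_swap
    exact h.ne (congrArg Prod.fst (τ.injective this)).symm
  mark i w := by
    rintro ⟨h, b, hb⟩
    rw [hτ.apply_markFoot] at hb
    exact absurd hb Sum.inr_ne_inl
  line := by
    obtain ⟨b, b', w, h, hbb, hb, hb'⟩ := hτ.exists_slots_lineVertex
    refine ⟨w, ⟨h, b', hb'⟩, ?_⟩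
    rintro w' ⟨h', b'', hb''⟩
    rcases eq_of_slots (b'' := b'') hbb with rfl | rfl
    · rw [hb] at hb''
      simp at hb''
    · rw [hb'] at hb''
      exact (eq_of_row_eq hb'').symm
  unmarked v hv := by
    obtain ⟨w₁, h₁, hw₁⟩ := hτ.exists_eq_some hv 0
    obtain ⟨w₂, h₂, hw₂⟩ := hτ.exists_eq_some hv 1
    refine ⟨w₁, w₂, ?_, fun w => ⟨?_, ?_⟩⟩
    · rintro rfl
      rw [← hw₁] at hw₂
      have := τ.injective hw₂
      simp at this
    · rintro ⟨h, b, hb⟩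
      rcases eq_of_slots (b'' := b) (zero_ne_one (α := Fin 2)) with rfl | rfl
      · left
        rw [hw₁] at hb
        exact (eq_of_row_eq hb).symm
      · right
        rw [hw₂] at hb
        exact (eq_of_row_eq hb).symm
    · rintro (rfl | rfl)
      exacts [⟨h₁, 0, hw₁⟩, ⟨h₂, 1, hw₂⟩]

/-- The equations assigned to a vertex only involve this vertex and the origins of the arrows that
point to it. -/
theorem eq_or_arrow (hτ : IsAssignment u τ) (w : Γ.V) (b : Fin 2) (v : Γ.V) (b' : Fin 2)
    (h : momentMatrix ℤ Γ.incidence (Γ.slopes u) (τ (w, b)) (v, b') ≠ 0) :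
    v = w ∨ assignmentArrow τ v w := by
  by_contra hne
  rw [not_or] at hne
  apply h
  rcases hwb : τ (w, b) with (_ | ⟨e, he⟩) | ⟨i, b''⟩
  · obtain rfl := hτ.eq_lineVertex_of_eq_none hwb
    have h1 : ¬v = Γ.markFoot (Fin.last n) := hne.1
    simp [momentMatrix, incidence, TropDesc.incidence, h1]
  · have hv : v ∉ e := by
      intro hv
      have hw : w ∈ e := hτ.mem_of_eq_some hwb
      obtain rfl := (Sym2.mem_and_mem_iff hne.1).1 ⟨hv, hw⟩
      exact hne.2 ⟨he, b, hwb⟩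
    have h1 := incidence_some_eq_zero (Γ := Γ) (e := ⟨e, he⟩) hv
    simp [momentMatrix, h1]
  · have h1 : w = Γ.markFoot i.castSucc := by
      rw [← hτ.apply_markFoot i b''] at hwb
      exact congrArg Prod.fst (τ.injective hwb)
    have h2 : ¬v = Γ.markFoot i.castSucc := h1 ▸ hne.1
    simp [momentMatrix, incidence, TropDesc.incidence, h2]

/-- The `2 × 2` determinant at a vertex whose slots are taken by two edges or by an edge and the
line. -/
theorem natAbs_block {v : Γ.V} {b b' : Fin 2} (hb : b ≠ b') {k k' : Option Γ.graph.edgeSet}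
    (hk : τ (v, b) = Sum.inl k) (hk' : τ (v, b') = Sum.inl k')
    (hc : (Γ.incidence (Sum.inl k) v).natAbs = 1) (hc' : (Γ.incidence (Sum.inl k') v).natAbs = 1) :
    (momentMatrix ℤ Γ.incidence (Γ.slopes u) (τ (v, 0)) (v, 0) *
        momentMatrix ℤ Γ.incidence (Γ.slopes u) (τ (v, 1)) (v, 1) -
      momentMatrix ℤ Γ.incidence (Γ.slopes u) (τ (v, 0)) (v, 1) *
        momentMatrix ℤ Γ.incidence (Γ.slopes u) (τ (v, 1)) (v, 0)).natAbs =
      (det (Γ.slopes u k) (Γ.slopes u k')).natAbs := by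
  have key : ∀ l l' : Option Γ.graph.edgeSet, τ (v, 0) = Sum.inl l → τ (v, 1) = Sum.inl l' →
      (momentMatrix ℤ Γ.incidence (Γ.slopes u) (τ (v, 0)) (v, 0) *
        momentMatrix ℤ Γ.incidence (Γ.slopes u) (τ (v, 1)) (v, 1) -
      momentMatrix ℤ Γ.incidence (Γ.slopes u) (τ (v, 0)) (v, 1) *
        momentMatrix ℤ Γ.incidence (Γ.slopes u) (τ (v, 1)) (v, 0)) =
      Γ.incidence (Sum.inl l) v * Γ.incidence (Sum.inl l') v *
        det (Γ.slopes u l) (Γ.slopes u l') := by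
    intro l l' hl hl'
    rw [hl, hl']
    simp only [momentMatrix, of_apply, Sum.elim_inl, Int.cast_id, cons_val_zero, cons_val_one, det]
    ring
  have hcases : (b = 0 ∧ b' = 1) ∨ (b = 1 ∧ b' = 0) := by omega
  rcases hcases with ⟨rfl, rfl⟩ | ⟨rfl, rfl⟩
  · rw [key k k' hk hk', Int.natAbs_mul, Int.natAbs_mul, hc, hc', one_mul, one_mul]
  · rw [key k' k hk' hk, Int.natAbs_mul, Int.natAbs_mul, hc, hc', one_mul, one_mul,
      natAbs_det_comm]

/-- The determinant of the system of equations is the product of the determinant of the line and the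
edge that points to it, and of the multiplicities of the unmarked vertices. -/
theorem natAbs_det (hτ : IsAssignment u τ) {κ : Fin (n + 1) → ℕ} (hΓ : Γ.IsPsiType κ) {w₀ : Γ.V}
    (hw₀ : assignmentArrow τ w₀ Γ.lineVertex) {m : Γ.V → ℕ}
    (hm : ∀ v, Γ.IsUnmarked v → Γ.valency v = 3 → Γ.IsVertexMultiplicity v (m v)) :
    ((momentMatrix ℤ Γ.incidence (Γ.slopes u)).submatrix τ id).det.natAbs =
      (det u (Γ.slope Γ.lineVertex w₀)).natAbs *
        ∏ v with Γ.IsUnmarked v ∧ Γ.valency v = 3, m v := by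
  have hdet := det_eq_prod_of_acyclic
    ((momentMatrix ℤ Γ.incidence (Γ.slopes u)).submatrix τ id) hτ.isFlow.irrefl hτ.eq_or_arrow
  have hline : (det u (Γ.slope Γ.lineVertex w₀)).natAbs =
      ∏ v, if v = Γ.lineVertex then (det u (Γ.slope Γ.lineVertex w₀)).natAbs else 1 := by
    simp
  rw [hdet, ← Int.natAbsHom_apply, map_prod, Finset.prod_filter, hline, ← Finset.prod_mul_distrib]
  refine Finset.prod_congr rfl fun v _ => ?_
  rw [Int.natAbsHom_apply]
  by_cases hv : Γ.IsUnmarked v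
  · have hval := valency_of_isUnmarked hΓ hv
    have hvl : v ≠ Γ.lineVertex := (hv (Fin.last n)).symm
    rw [if_neg hvl, if_pos ⟨hv, hval⟩, one_mul]
    obtain ⟨w₁, h₁, hw₁⟩ := hτ.exists_eq_some hv 0
    obtain ⟨w₂, h₂, hw₂⟩ := hτ.exists_eq_some hv 1
    have hne : w₁ ≠ w₂ := by
      rintro rfl
      rw [← hw₁] at hw₂
      have := τ.injective hw₂
      simp at this
    refine (natAbs_block zero_ne_one hw₁ hw₂ (natAbs_incidence_some (Sym2.mem_mk_right _ _))
      (natAbs_incidence_some (Sym2.mem_mk_right _ _))).trans ?_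
    obtain ⟨a, b, hab, ha, hb, hmv⟩ := hm v hv hval
    rw [hmv]
    refine Eq.trans ?_ (natAbs_det_eq_of_sum_eq_zero ((card_flags hv).trans hval) (sum_flagSlope v)
      (a := Sum.inl w₁) (b := Sum.inl w₂)
      (mem_flags.2 h₁.symm) (mem_flags.2 h₂.symm) (fun h => hne (Sum.inl.inj h))
      (mem_flags.2 ha) (mem_flags.2 hb) hab)
    change (det (Γ.edgeSlope _) (Γ.edgeSlope _)).natAbs =
      (det (Γ.slope v w₁) (Γ.slope v w₂)).natAbs
    rcases edgeSlope_eq_or h₁ with h3 | h3 <;> rcases edgeSlope_eq_or h₂ with h4 | h4 <;>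
      simp only [h3, h4, natAbs_det_neg_left, natAbs_det_neg_right]
  · rw [if_neg (c := Γ.IsUnmarked v ∧ Γ.valency v = 3) fun h => hv h.1, mul_one]
    split_ifs with hvl
    · subst hvl
      obtain ⟨b, b', w, h, hbb, hb, hb'⟩ := hτ.exists_slots_lineVertex
      obtain rfl : w = w₀ := hτ.isFlow.line.unique ⟨h, b', hb'⟩ hw₀
      refine (natAbs_block hbb hb hb' ?_ (natAbs_incidence_some (Sym2.mem_mk_right _ _))).trans ?_
      · simp [incidence, TropDesc.incidence, lineVertex]
      · change (det u (Γ.edgeSlope _)).natAbs = _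
        rcases edgeSlope_eq_or h with h3 | h3 <;> rw [h3]
        rw [natAbs_det_neg_right]
    · simp only [IsUnmarked, ne_eq, not_forall, not_not] at hv
      obtain ⟨i, rfl⟩ := hv
      induction i using Fin.lastCases with
      | last => exact absurd rfl hvl
      | cast i =>
        simp [hτ.apply_markFoot, momentMatrix, incidence, TropDesc.incidence]

end IsAssignment

end CombType

end TropDesc

theorem mainTheorem9 (d k n : ℕ) (hn : n + k + 1 = 3 * d) :
    ∃ S : Finset (Submodule ℝ ((Fin n → ℝ × ℝ) × (ℝ × ℝ))), (∀ W ∈ S, W ≠ ⊤) ∧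
      ∀ (P : Fin n → ℝ × ℝ) (Q : ℝ × ℝ), (∀ W ∈ S, (P, Q) ∉ W) →
        ∀ Γ : TropDesc.CombType d n, Γ.IsPsiType (TropDesc.lastPsi n k) →
          ∀ h : Γ.Curve, h.Satisfies P Q →
            (∀ e, 0 < h.len e) ∧
            (∃! j, h.pos Γ.lineVertex ∈ TropDesc.openRay Q j) ∧
            (∃! c : Γ.Component, c.IsBounded) ∧
            (∃! w, Γ.IsBoundedDirection Γ.lineVertex w) ∧
            ∀ j, h.pos Γ.lineVertex ∈ TropDesc.openRay Q j →
              ∀ w, Γ.IsBoundedDirection Γ.lineVertex w →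
                ∀ m : Γ.V → ℕ,
                  (∀ v, Γ.IsUnmarked v → Γ.valency v = 3 → Γ.IsVertexMultiplicity v (m v)) →
                  Γ.multiplicity (TropDesc.lastPsi n k) (TropDesc.dir j) =
                    (TropDesc.det (TropDesc.dir j) (Γ.slope Γ.lineVertex w)).natAbs *
                      ∏ v with Γ.IsUnmarked v ∧ Γ.valency v = 3, m v := by
  refine ⟨TropDesc.exceptionalSubspaces d n, fun W hW => ?_, ?_⟩
  · classical
    simp only [TropDesc.exceptionalSubspaces, Finset.mem_erase] at hW
    exact hW.1
  intro P Q hPQ Γ hΓ h hsat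
  obtain ⟨hP, hQ⟩ := hsat
  obtain ⟨j₀, hj₀⟩ := Set.mem_iUnion.1 hQ
  obtain ⟨τ₀⟩ := Γ.nonempty_rows_equiv hn hΓ
  obtain ⟨hlen, hopen, hsurj⟩ := Γ.regular_of_satisfies hn hPQ hΓ h hP hj₀
  obtain ⟨τ, hdet, hτ⟩ := TropDesc.exists_assignment τ₀ hsurj
  have hτ' : TropDesc.CombType.IsAssignment (TropDesc.dir j₀) τ := hτ
  have hF := hτ'.isFlow
  have hdir := hF.isBoundedDirection_iff hΓ
  refine ⟨hlen, ⟨j₀, hopen, fun j hj => TropDesc.eq_of_mem_openRay hj hopen⟩,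
    hF.existsUnique_isBounded hΓ, ?_, ?_⟩
  · simpa only [hdir] using hF.line
  · intro j hj w hw m hm
    obtain rfl := TropDesc.eq_of_mem_openRay hj hopen
    have hs := TropDesc.slope_ne_zero_of_injective
      (TropDesc.constraintMap_injective_of_surjective τ₀ hsurj)
    rw [Γ.multiplicity_eq_index, TropDesc.index_range_constraintMap hs τ hdet]
    exact hτ'.natAbs_det hΓ ((hdir w).1 hw) hm
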